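/- All graphs are finite and simple. Let $B$ be a bipartite graph. For an edge $e=uv$ of a graph $H$ put $N_H[e]=N_H[u]\cup N_H[v]$, where $N_H(x)$ is the set of neighbours of $x$ in $H$ and $N_H[x]=N_H(x)\cup\{x\}$. An edge $e$ of $H$ is \emph{bisimplicial} if the subgraph of $H$ induced on $N_H[e]$ is a complete bipartite graph $K_{p,q}$ with $p,q\ge 1$. A vertex $x$ of $H$ is \emph{simple} if for all $u,v\in N_H(x)$ one has $N_H(u)\subseteq N_H(v)$ or $N_H(v)\subseteq N_H(u)$. For a sequence $\mathcal E=(e_1,\dots,e_k)$, $k\ge 1$, of distinct edges of $B$ put $B_0=B$ and $B_i=B_{i-1}-N_{B_{i-1}}[e_i]$ for $1\le i\le k$. The sequence $\mathcal E$ is a \emph{biclique elimination sequence} of $B$ if $e_i$ is a bisimplicial edge of $B_{i-1}$ for every $1\le i\le k$ and $B_k$ has no edges. It is \emph{simple} if moreover, for every $1\le i\le k$, at least one end vertex of $e_i$ is a simple vertex of $B_{i-1}$. It is \emph{complete} if for every $1\le i\le k$ the graph $B_i=B_{i-1}-N_{B_{i-1}}[e_i]$ has no isolated vertices. Let $S(B)$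 be the graph obtained from $B$ by replacing every edge by a path of length two, and let $\operatorname{Ind}(S(B))$ be its independence complex, whose faces are the independent sets of $S(B)$. (1) If $B$ admits a complete simple biclique elimination sequence $\mathcal E$, then every simple biclique elimination sequence of $B$ is complete and has length $|\mathcal E|$. (2) If $B$ admits a simple biclique elimination sequence, then (the geometric realization of) $\operatorname{Ind}(S(B))$ is homotopy equivalent to a sphere $\mathbb S^d$ for some $d\ge 0$ if and only if $B$ admits a complete simple biclique elimination sequence. -/

import Mathlib

namespace BicliqueElim

open scoped ContinuousMap

/-! ### Graph notions

A graph obtained from `G` by successively deleting vertices is handled as a subgraph `H` of `G`. -/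

section Graph

variable {V : Type*} {G : SimpleGraph V}

/-- The closed neighbourhood `N_H[e]` of an edge `e = uv`, namely `N_H[u] ∪ N_H[v]`. -/
def edgeNbhd (H : G.Subgraph) (e : Sym2 V) : Set V :=
  {w | ∃ v ∈ e, w = v ∨ H.Adj v w}

/-- A graph is a biclique if it is isomorphic to `K_{p,q}` for some `p, q ≥ 1`. -/
def IsBiclique {W : Type*} (K : SimpleGraph W) : Prop :=
  ∃ p q : ℕ, 1 ≤ p ∧ 1 ≤ q ∧ Nonempty (K ≃g completeBipartiteGraph (Fin p) (Fin q))

/-- A vertex is simple if the neighbourhoods of its neighbours are pairwise comparable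
under inclusion. -/
def IsSimpleVertex (H : G.Subgraph) (x : V) : Prop :=
  x ∈ H.verts ∧ ∀ u ∈ H.neighborSet x, ∀ v ∈ H.neighborSet x,
    H.neighborSet u ⊆ H.neighborSet v ∨ H.neighborSet v ⊆ H.neighborSet u

/-- An edge `e` of `H` is bisimplicial if `N_H[e]` induces a biclique in `H`. -/
def IsBisimplicialEdge (H : G.Subgraph) (e : Sym2 V) : Prop :=
  e ∈ H.edgeSet ∧ IsBiclique (H.induce (edgeNbhd H e)).coe

/-- `H - N_H[e]`. -/
def elimStep (H : G.Subgraph) (e : Sym2 V) : G.Subgraph :=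
  H.deleteVerts (edgeNbhd H e)

/-- The graph `B_i` for the sequence `E = [e_1, …, e_k]`: starting from `B_0 = G`, delete
successively the closed neighbourhoods of `e_1, …, e_i`, each taken in the current graph. -/
def elimGraph (G : SimpleGraph V) (E : List (Sym2 V)) (i : ℕ) : G.Subgraph :=
  (E.take i).foldl elimStep ⊤

/-- `E = [e_1, …, e_k]`, `k ≥ 1`, is a biclique elimination sequence of `G`
(`E[i]` is `e_{i+1}`). -/
structure IsElimSeq (G : SimpleGraph V) (E : List (Sym2 V)) : Prop where
  ne_nil : E ≠ []
  nodup : E.Nodup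
  bisimplicial : ∀ (i : ℕ) (hi : i < E.length), IsBisimplicialEdge (elimGraph G E i) E[i]
  edgeless : (elimGraph G E E.length).edgeSet = ∅

/-- A simple biclique elimination sequence: moreover at least one end vertex of each `e_{i+1}` is
a simple vertex of `B_i`. -/
structure IsSimpleElimSeq (G : SimpleGraph V) (E : List (Sym2 V)) : Prop
    extends IsElimSeq G E where
  simple : ∀ (i : ℕ) (hi : i < E.length), ∃ x ∈ E[i], IsSimpleVertex (elimGraph G E i) x

/-- `Iso_H(e)`: the isolated vertices of `H - N_H[e]`. -/
def iso (H : G.Subgraph) (e : Sym2 V) : Set V :=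
  {v | v ∈ (elimStep H e).verts ∧ ∀ w, ¬ (elimStep H e).Adj v w}

/-- `Iso_G(E)`: the union of the sets `Iso_{B_{i-1}}(e_i)`. -/
def isoSeq (G : SimpleGraph V) (E : List (Sym2 V)) : Set V :=
  ⋃ (i : ℕ) (hi : i < E.length), iso (elimGraph G E i) E[i]

/-- A complete simple biclique elimination sequence. -/
def IsCompleteSimpleElimSeq (G : SimpleGraph V) (E : List (Sym2 V)) : Prop :=
  IsSimpleElimSeq G E ∧ isoSeq G E = ∅

/-- The `1`-subdivision graph `S(G)`: each edge `e = uv` is replaced by a path `u, e, v`. -/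
def subdivision (G : SimpleGraph V) : SimpleGraph (V ⊕ G.edgeSet) where
  Adj a b := match a, b with
    | .inl v, .inr e => v ∈ (e : Sym2 V)
    | .inr e, .inl v => v ∈ (e : Sym2 V)
    | _, _ => False
  symm := ⟨by rintro (v | e) (w | f) h <;> exact h⟩
  loopless := ⟨by rintro (v | e) h <;> exact h⟩

/-- The independence complex `Ind(G)` (faces are the nonempty independent sets). -/
def indComplex (G : SimpleGraph V) : AbstractSimplicialComplex V where
  faces := {s | s.Nonempty ∧ G.IsIndepSet (s : Set V)}
  isRelLowerSet_faces := fun _ hs =>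
    ⟨hs.1, fun _ hts ht => ⟨ht, hs.2.mono (Finset.coe_subset.2 hts)⟩⟩
  singleton_mem := fun v => ⟨Finset.singleton_nonempty v, by
    simp [SimpleGraph.IsIndepSet]⟩

end Graph

/-! ### Topology -/

/-- The geometric realization of a finite abstract simplicial complex, by barycentric
coordinates: points of the standard simplex whose support is contained in a face, with the
subspace topology. -/
def realization {ι : Type*} [Finite ι] (K : AbstractSimplicialComplex ι) : Set (ι → ℝ) :=
  {x | (∀ i, 0 ≤ x i) ∧ ∃ s ∈ K.faces, (∀ i ∉ s, x i = 0) ∧ ∑ i ∈ s, x i = 1}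

/-- `X` is homotopy equivalent to the unit sphere of `ℝ^{d+1}` for some `d ≥ 0`. -/
def IsHomotopySphere (X : Type*) [TopologicalSpace X] : Prop :=
  ∃ d : ℕ, Nonempty (X ≃ₕ Metric.sphere (0 : EuclideanSpace ℝ (Fin (d + 1))) 1)

end BicliqueElim

/-! Only the vertex sets of the graphs `B_i` matter, since each `B_i` is induced in `B`. An isolated
vertex, once created, is never deleted later, so a sequence is complete exactly when it ends with no
vertices at all (`IsElimSeq.verts_eq_empty`, `IsElimSeq.isoSeq_eq_empty`).

The first assertion is a confluence argument (`Reducible.exists_remaining`). Take two bisimplicial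
edges in a graph that can be reduced to nothing. If an end of one is adjacent to an end of the
other, they delete the same vertices, because otherwise the first would strand a vertex
(`remaining_eq_of_adj`). If not, each survives the other and the two deletions commute. Hence every
available step can start a full reduction of the same length.

For the second assertion, a bisimplicial edge is removed from the subdivision by homotopy
equivalences of independence complexes. If `N(v) ⊆ N(w)`, then `w` splits off together with one
subdivided edge as an isolated edge `K_2` (`IsSplit.exists_homotopyEquiv_of_dominated`).
Bisimpliciality of `uv` provides such dominations until `uv` is an isolated edge, which also becomes
a `K_2`. A whole elimination sequence therefore leaves a matching together with the undeleted
vertices. A leftover vertex is a cone apex, so the complex is contractible; with none left, the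
complex of the matching is the boundary of a cross-polytope, a sphere.

It remains to separate the two cases: a sphere is not contractible (`not_contractibleSpace_sphere`).
A contraction would yield a `C^1` map of a ball into its boundary fixing the boundary pointwise. The
integral of its Jacobian would be both the volume of the ball (`integral_det_fderiv_eq_volume`) and
zero. -/

namespace BicliqueElim

open MeasureTheory Metric Set

/-! ### Noncontractibility of spheres, by integrating Jacobians. -/

section NoRetraction

/-- A fixed affine combination of values `det (1 + t A)` at small `t` computes `det (1 + A)`. -/
lemma exists_det_one_add_eq_sum {n : ℕ} {ε : ℝ} (hε : 0 < ε) :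
    ∃ (s : Finset ℝ) (c : ℝ → ℝ), (∀ t ∈ s, 0 ≤ t ∧ t ≤ ε) ∧
      ∀ A : EuclideanSpace ℝ (Fin n) →L[ℝ] EuclideanSpace ℝ (Fin n),
        (1 + A).det = ∑ t ∈ s, c t * (1 + t • A).det := by
  -- `det (1 + t A)` is a polynomial in `t` of degree at most `n`, so `n + 1` nodes in `[0, ε]`
  -- determine its value at `t = 1`. The Lagrange weights depend only on the nodes, not on `A`.
  obtain ⟨s, hs, hcard⟩ := (Set.Icc_infinite hε).exists_subset_card_eq (n + 1)
  refine ⟨s, fun t => (Lagrange.basis s id t).eval 1, fun t ht => hs ht, fun A => ?_⟩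
  let b := (EuclideanSpace.basisFun (Fin n) ℝ).toBasis
  let M := LinearMap.toMatrix b b (A : EuclideanSpace ℝ (Fin n) →ₗ[ℝ] EuclideanSpace ℝ (Fin n))
  let P : Polynomial ℝ := ((Polynomial.X : Polynomial ℝ) • M.map Polynomial.C
    + (1 : Matrix (Fin n) (Fin n) ℝ).map Polynomial.C).det
  have hP : ∀ t : ℝ, P.eval t = (1 + t • A).det := by
    intro t
    rw [ContinuousLinearMap.det, ← LinearMap.det_toMatrix b]
    have : LinearMap.toMatrix b b ((1 + t • A : EuclideanSpace ℝ (Fin n) →L[ℝ] _) :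
        EuclideanSpace ℝ (Fin n) →ₗ[ℝ] EuclideanSpace ℝ (Fin n)) = t • M + 1 := by
      have h1 : ((1 + t • A : EuclideanSpace ℝ (Fin n) →L[ℝ] _) :
        EuclideanSpace ℝ (Fin n) →ₗ[ℝ] EuclideanSpace ℝ (Fin n)) = t • (A : EuclideanSpace ℝ (Fin n) →ₗ[ℝ]
          EuclideanSpace ℝ (Fin n)) + 1 := by
        ext x; simp [add_comm]
      rw [h1, map_add, map_smul, LinearMap.toMatrix_one]
    rw [this]
    simp only [P]
    rw [← Polynomial.coe_evalRingHom, RingHom.map_det]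
    congr 1
    ext i j
    change Polynomial.eval t (((Polynomial.X : Polynomial ℝ) • M.map Polynomial.C
      + (1 : Matrix (Fin n) (Fin n) ℝ).map Polynomial.C) i j) = (t • M + 1) i j
    simp only [Matrix.add_apply, Matrix.smul_apply, Matrix.map_apply, smul_eq_mul,
      Polynomial.eval_add, Polynomial.eval_mul, Polynomial.eval_X, Polynomial.eval_C]
  have hdeg : P.degree < s.card := by
    refine lt_of_le_of_lt Polynomial.degree_le_natDegree ?_
    rw [hcard]
    have := Polynomial.natDegree_det_X_add_C_le M 1
    rw [Fintype.card_fin] at this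
    exact_mod_cast Nat.lt_succ_of_le this
  have key := Lagrange.eq_interpolate (v := id) (s := s) (Set.injOn_id _) hdeg
  have := congrArg (Polynomial.eval 1) key
  rw [hP 1, Lagrange.interpolate_apply, Polynomial.eval_finsetSum] at this
  rw [one_smul] at this
  rw [this]
  refine Finset.sum_congr rfl fun t _ => ?_
  simp [hP, mul_comm]

/-- By the Neumann series `1 + s A` is invertible for all `s ∈ [0, 1]`, so the determinant cannot
change sign on the way from its value `1` at `s = 0`. -/
lemma det_one_add_pos {E : Type*} [NormedAddCommGroup E] [NormedSpace ℝ E] [CompleteSpace E]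
    [FiniteDimensional ℝ E] (A : E →L[ℝ] E) (hA : ‖A‖ < 1) : 0 < (1 + A).det := by
  have hne : ∀ s ∈ Icc (0 : ℝ) 1, (1 + s • A).det ≠ 0 := by
    intro s hs
    have h1 : ‖-(s • A)‖ < 1 := by
      rw [norm_neg, norm_smul, Real.norm_of_nonneg hs.1]
      calc s * ‖A‖ ≤ 1 * ‖A‖ := by gcongr; exact hs.2
        _ < 1 := by simpa using hA
    have hu := isUnit_one_sub_of_norm_lt_one h1
    rw [sub_neg_eq_add] at hu
    have : IsUnit ((1 + s • A : E →L[ℝ] E) : E →ₗ[ℝ] E) :=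
      hu.map (ContinuousLinearMap.toLinearMapRingHom (R₁ := ℝ) (M₁ := E))
    exact (this.map (LinearMap.det (M := E) (A := ℝ))).ne_zero
  have hcont : ContinuousOn (fun s : ℝ => (1 + s • A).det) (Icc 0 1) := by
    apply Continuous.continuousOn
    exact ContinuousLinearMap.continuous_det.comp (by fun_prop)
  by_contra! hle
  have hmem : (0 : ℝ) ∈ Icc ((1 + (1 : ℝ) • A).det) ((1 + (0 : ℝ) • A).det) := by
    constructor
    · simpa using hle
    · simp [ContinuousLinearMap.det]
  obtain ⟨s, hs, h0⟩ := intermediate_value_Icc' zero_le_one hcont hmem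
  exact hne s hs h0

/-- Extension by zero preserves Lipschitz bounds for maps vanishing on the sphere. -/
lemma lipschitzWith_indicator_closedBall {E : Type*} [NormedAddCommGroup E] [NormedSpace ℝ E]
    {g : E → E} {C : NNReal} {r : ℝ} (hg : LipschitzOnWith C g (closedBall 0 r))
    (h0 : ∀ x ∈ sphere (0 : E) r, g x = 0) :
    LipschitzWith C ((closedBall (0 : E) r).indicator g) := by
  have key : ∀ x ∈ closedBall (0 : E) r, ∀ y ∉ closedBall (0 : E) r,
      dist (g x) 0 ≤ C * dist x y := by
    intro x hx y hy
    have hcont : ContinuousOn (fun s : ℝ => ‖x + s • (y - x)‖) (Icc 0 1) := by fun_prop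
    have hmem : r ∈ Icc ‖x + (0 : ℝ) • (y - x)‖ ‖x + (1 : ℝ) • (y - x)‖ := by
      constructor
      · simpa using hx
      · simp only [mem_closedBall, dist_zero_right, not_le] at hy
        simpa using hy.le
    -- The segment from `x` to the outside point `y` crosses the sphere, where `g` vanishes; the
    -- crossing point is no farther from `x` than `y` is.
    obtain ⟨s, hs, hsr⟩ := intermediate_value_Icc zero_le_one hcont hmem
    have hsr' : x + s • (y - x) ∈ sphere (0 : E) r := by simpa using hsr
    rw [← h0 _ hsr']
    refine (hg.dist_le_mul x hx _ (sphere_subset_closedBall hsr')).trans ?_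
    gcongr
    rw [dist_eq_norm, dist_eq_norm]
    have : x - (x + s • (y - x)) = s • (x - y) := by
      rw [smul_sub, smul_sub]; abel
    rw [this, norm_smul, Real.norm_of_nonneg hs.1]
    exact mul_le_of_le_one_left (norm_nonneg _) hs.2
  refine LipschitzWith.of_dist_le_mul fun x y => ?_
  by_cases hx : x ∈ closedBall (0 : E) r <;> by_cases hy : y ∈ closedBall (0 : E) r
  · rw [indicator_of_mem hx, indicator_of_mem hy]
    exact hg.dist_le_mul x hx y hy
  · rw [indicator_of_mem hx, indicator_of_notMem hy]
    exact key x hx y hy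
  · rw [indicator_of_notMem hx, indicator_of_mem hy, dist_comm, dist_comm x]
    exact key y hy x hx
  · rw [indicator_of_notMem hx, indicator_of_notMem hy]
    simp; positivity

/-- The degree formula for maps of a ball that fix its boundary. -/
lemma integral_det_fderiv_eq_volume {n : ℕ} {r : ℝ}
    {f : EuclideanSpace ℝ (Fin n) → EuclideanSpace ℝ (Fin n)} (hf : ContDiff ℝ 1 f)
    (hfr : ∀ x ∈ sphere (0 : EuclideanSpace ℝ (Fin n)) r, f x = x) :
    ∫ x in closedBall (0 : EuclideanSpace ℝ (Fin n)) r, (fderiv ℝ f x).det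
      = volume.real (closedBall (0 : EuclideanSpace ℝ (Fin n)) r) := by
  set D := closedBall (0 : EuclideanSpace ℝ (Fin n)) r with hD
  set g : EuclideanSpace ℝ (Fin n) → EuclideanSpace ℝ (Fin n) := fun x => f x - x with hgdef
  have hg : ContDiff ℝ 1 g := hf.sub contDiff_id
  have hgf : ∀ x, fderiv ℝ f x = 1 + fderiv ℝ g x := by
    intro x
    have : fderiv ℝ g x = fderiv ℝ f x - fderiv ℝ id x :=
      fderiv_sub (hf.differentiable one_ne_zero x) differentiableAt_id
    rw [this, fderiv_id]
    ext v; simp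
  have hDc : IsCompact D := isCompact_closedBall 0 r
  have hg' : Continuous (fderiv ℝ g) := hg.continuous_fderiv one_ne_zero
  obtain ⟨C, hC⟩ : ∃ C : NNReal, ∀ x ∈ D, ‖fderiv ℝ g x‖₊ ≤ C := by
    obtain ⟨C, hC⟩ := (hDc.image hg'.nnnorm).bddAbove
    exact ⟨C, fun x hx => hC ⟨x, hx, rfl⟩⟩
  have hlip : LipschitzOnWith C g D :=
    (convex_closedBall 0 r).lipschitzOnWith_of_nnnorm_fderiv_le
      (fun x _ => hg.differentiable one_ne_zero x) hC
  have hlip' : LipschitzWith C (D.indicator g) :=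
    lipschitzWith_indicator_closedBall hlip fun x hx => by simp [hgdef, hfr x hx]
  obtain ⟨ε, hε, hεC⟩ : ∃ ε : ℝ, 0 < ε ∧ ε * C < 1 := by
    refine ⟨1 / (C + 1), by positivity, ?_⟩
    rw [one_div, inv_mul_lt_iff₀ (by positivity)]
    simp
  -- For small `t`, `x ↦ x + t g x` maps the ball bijectively to itself with positive Jacobian, so
  -- change of variables gives the volume. Bijectivity comes from extending `g` by zero: the
  -- extended map is a Lipschitz-small perturbation of the identity of the whole space, and is the
  -- identity off the ball.
  have hvol : ∀ t : ℝ, 0 ≤ t → t ≤ ε →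
      ∫ x in D, (1 + t • fderiv ℝ g x).det = volume.real D := by
    intro t ht0 htε
    have htC : t * C < 1 := lt_of_le_of_lt (by gcongr) hεC
    set F : EuclideanSpace ℝ (Fin n) → EuclideanSpace ℝ (Fin n) := fun x => x + t • g x with hF
    set F' : EuclideanSpace ℝ (Fin n) → EuclideanSpace ℝ (Fin n) :=
      fun x => x + t • D.indicator g x with hF'
    have hFF' : ∀ x ∈ D, F' x = F x := fun x hx => by simp [hF, hF', indicator_of_mem hx]
    have hFout : ∀ x ∉ D, F' x = x := fun x hx => by simp [hF', indicator_of_notMem hx]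
    let I := ContinuousLinearEquiv.refl ℝ (EuclideanSpace ℝ (Fin n))
    have happ : ApproximatesLinearOn F' (I : EuclideanSpace ℝ (Fin n) →L[ℝ] _) univ
        (t.toNNReal * C) := by
      rw [ApproximatesLinearOn.approximatesLinearOn_iff_lipschitzOnWith]
      refine LipschitzWith.lipschitzOnWith (LipschitzWith.of_dist_le_mul fun x y => ?_)
      have hsub : ∀ z, (F' - (I : EuclideanSpace ℝ (Fin n) →L[ℝ] EuclideanSpace ℝ (Fin n))) z = t • D.indicator g z :=
        fun z => add_sub_cancel_left _ _
      rw [hsub, hsub, dist_smul₀, Real.norm_of_nonneg ht0]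
      have := hlip'.dist_le_mul x y
      rw [NNReal.coe_mul, Real.coe_toNNReal t ht0, mul_assoc]
      exact mul_le_mul_of_nonneg_left this ht0
    have hc : Subsingleton (EuclideanSpace ℝ (Fin n)) ∨ (t.toNNReal * C : NNReal) <
        ‖(I.symm : EuclideanSpace ℝ (Fin n) →L[ℝ] EuclideanSpace ℝ (Fin n))‖₊⁻¹ := by
      rcases subsingleton_or_nontrivial (EuclideanSpace ℝ (Fin n)) with h | h
      · exact Or.inl h
      · right
        have : ‖(I.symm : EuclideanSpace ℝ (Fin n) →L[ℝ] EuclideanSpace ℝ (Fin n))‖₊ = 1 :=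
          NNReal.eq ContinuousLinearMap.norm_id
        rw [this, inv_one, ← NNReal.coe_lt_coe]
        rwa [NNReal.coe_mul, Real.coe_toNNReal t ht0]
    have hinj : Function.Injective F' := injOn_univ.1 (happ.injOn hc)
    have hsurj : Function.Surjective F' := happ.surjective hc
    have himg : F '' D = D := by
      rw [← image_congr hFF']
      apply Subset.antisymm
      · rintro _ ⟨x, hx, rfl⟩
        by_contra hn
        exact hn ((hinj (hFout _ hn)).symm ▸ hx)
      · intro y hy
        obtain ⟨x, rfl⟩ := hsurj y
        by_cases hx : x ∈ D
        · exact ⟨x, hx, rfl⟩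
        · rw [hFout x hx] at hy
          exact absurd hy hx
    have hinjD : InjOn F D := fun x hx y hy h => hinj (by rw [hFF' x hx, hFF' y hy, h])
    have hder : ∀ x ∈ D, HasFDerivWithinAt F (1 + t • fderiv ℝ g x) D x := fun x _ =>
      ((hasFDerivAt_id x).add
        ((hg.differentiable one_ne_zero x).hasFDerivAt.const_smul t)).hasFDerivWithinAt
    have hcv := integral_image_eq_integral_abs_det_fderiv_smul volume
      hDc.measurableSet hder hinjD (fun _ => (1 : ℝ))
    rw [himg] at hcv
    simp only [integral_const, smul_eq_mul, mul_one] at hcv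
    rw [measureReal_restrict_apply MeasurableSet.univ, univ_inter] at hcv
    rw [hcv]
    refine setIntegral_congr_fun hDc.measurableSet fun x hx => ?_
    refine (abs_of_pos (det_one_add_pos _ ?_)).symm
    rw [norm_smul, Real.norm_of_nonneg ht0]
    refine lt_of_le_of_lt ?_ htC
    exact mul_le_mul_of_nonneg_left (hC x hx) ht0
  -- Interpolation carries the equality from small `t` to `t = 1`, where `1 + t g'` is `f'`.
  obtain ⟨s, c, hs, hsum⟩ := exists_det_one_add_eq_sum (n := n) hε
  have hint : ∀ t : ℝ, IntegrableOn (fun x => (1 + t • fderiv ℝ g x).det) D := fun t =>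
    (ContinuousLinearMap.continuous_det.comp (by fun_prop)).continuousOn.integrableOn_compact hDc
  have hfsum : ∀ x, (fderiv ℝ f x).det = ∑ t ∈ s, c t * (1 + t • fderiv ℝ g x).det := fun x => by
    rw [hgf, hsum]
  simp only [hfsum]
  rw [integral_finsetSum _ fun t _ => (hint t).const_mul _]
  have h1 : ∑ t ∈ s, c t = 1 := by
    have h0 : (1 : EuclideanSpace ℝ (Fin n) →L[ℝ] EuclideanSpace ℝ (Fin n)).det = 1 :=
      LinearMap.det_id
    have := hsum 0
    have hz : ∀ t : ℝ, (1 + t • (0 : EuclideanSpace ℝ (Fin n) →L[ℝ] EuclideanSpace ℝ (Fin n))).det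
        = 1 := fun t => by rw [← h0]; congr 1; ext v; simp
    simp only [hz, add_zero, h0, mul_one] at this
    exact this.symm
  rw [← one_mul (volume.real D), ← h1, Finset.sum_mul]
  refine Finset.sum_congr rfl fun t ht => ?_
  rw [integral_const_mul, hvol t (hs t ht).1 (hs t ht).2]

/-- Differentiating `‖f‖²` shows that the image of the derivative is orthogonal to `f x ≠ 0`, so the
derivative is not surjective. -/
lemma det_fderiv_eq_zero_of_norm_const {n : ℕ} {r : ℝ} (hr : 0 < r)
    {f : EuclideanSpace ℝ (Fin n) → EuclideanSpace ℝ (Fin n)} (hf : Differentiable ℝ f)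
    (hfr : ∀ x, ‖f x‖ = r) (x : EuclideanSpace ℝ (Fin n)) : (fderiv ℝ f x).det = 0 := by
  by_contra hdet
  have h1 : ∀ v, inner ℝ (f x) (fderiv ℝ f x v) = 0 := by
    intro v
    have hd := (hf x).hasFDerivAt.norm_sq
    have hc : (fun y => ‖f y‖ ^ 2) = fun _ => r ^ 2 := by ext y; rw [hfr]
    rw [hc] at hd
    have := congrArg (fun L => L v) (hd.unique (hasFDerivAt_const _ x))
    simpa using this
  have hsurj : Function.Surjective (fderiv ℝ f x) := by
    let L := ((fderiv ℝ f x : EuclideanSpace ℝ (Fin n) →L[ℝ] EuclideanSpace ℝ (Fin n)) :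
      EuclideanSpace ℝ (Fin n) →ₗ[ℝ] EuclideanSpace ℝ (Fin n))
    have hL : IsUnit L := (LinearMap.isUnit_iff_isUnit_det L).2 (isUnit_iff_ne_zero.2 hdet)
    exact ((Module.End.isUnit_iff L).1 hL).surjective
  obtain ⟨v, hv⟩ := hsurj (f x)
  have := h1 v
  rw [hv, real_inner_self_eq_norm_sq, hfr] at this
  exact (pow_pos hr 2).ne' this

/-- The unit sphere is not contractible. -/
theorem not_contractibleSpace_sphere (d : ℕ) :
    ¬ ContractibleSpace (sphere (0 : EuclideanSpace ℝ (Fin (d + 1))) 1) := by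
  intro hcon
  obtain ⟨s0, ⟨H⟩⟩ := (contractible_iff_id_nullhomotopic _).1 hcon
  let E := EuclideanSpace ℝ (Fin (d + 1))
  -- The value `s0` at the origin is harmless: the homotopy is already constant on the ball of
  -- radius `1/2`.
  let nrm : E → sphere (0 : E) 1 := fun x =>
    if h : x = 0 then s0 else ⟨‖x‖⁻¹ • x, by
      rw [mem_sphere_zero_iff_norm, norm_smul, norm_inv, norm_norm,
        inv_mul_cancel₀ (norm_ne_zero_iff.2 h)]⟩
  have hnrm : ∀ x : E, x ≠ 0 → ((nrm x : sphere (0 : E) 1) : E) = ‖x‖⁻¹ • x := fun x hx => by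
    simp [nrm, hx]
  have hnrmc : ContinuousOn nrm {0}ᶜ := by
    rw [Topology.IsInducing.subtypeVal.continuousOn_iff]
    refine ContinuousOn.congr (f := fun x : E => ‖x‖⁻¹ • x) ?_ fun x hx => hnrm x hx
    exact (continuous_norm.continuousOn.inv₀ fun x hx => norm_ne_zero_iff.2 hx).smul continuousOn_id
  -- The time is `1` for `‖x‖ ≤ 1/2` and `0` for `‖x‖ ≥ 1`. Thus `F` is constant near the origin,
  -- the identity outside the unit ball, and of norm at least `1` everywhere.
  let τ : E → unitInterval := fun x => Set.projIcc 0 1 zero_le_one (2 - 2 * ‖x‖)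
  have hτ : Continuous τ := continuous_projIcc.comp (by fun_prop)
  let F : E → E := fun x => max 1 ‖x‖ • ((H (τ x, nrm x) : sphere (0 : E) 1) : E)
  have hFsmall : ∀ x : E, ‖x‖ ≤ 1 / 2 → F x = s0 := by
    intro x hx
    have h1 : τ x = 1 := Set.projIcc_of_right_le _ (by linarith)
    simp only [F, h1]
    rw [max_eq_left (by linarith)]
    simp
  have hFlarge : ∀ x : E, 1 ≤ ‖x‖ → F x = x := by
    intro x hx
    have h1 : τ x = 0 := Set.projIcc_of_le_left _ (by linarith)
    have hx0 : x ≠ 0 := by rintro rfl; simp at hx; linarith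
    simp only [F, h1]
    rw [max_eq_right hx]
    simp [hnrm x hx0, smul_smul, mul_inv_cancel₀ (norm_ne_zero_iff.2 hx0)]
  have hFnorm : ∀ x : E, 1 ≤ ‖F x‖ := by
    intro x
    simp only [F, norm_smul]
    rw [norm_eq_of_mem_sphere]
    simp [abs_of_nonneg]
  have hFc : Continuous F := by
    rw [continuous_iff_continuousAt]
    intro x
    by_cases hx : x = 0
    · have : F =ᶠ[nhds x] fun _ => (s0 : E) := by
        filter_upwards [ball_mem_nhds x (show (0 : ℝ) < 1 / 2 by norm_num)] with y hy
        apply hFsmall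
        rw [hx, mem_ball_zero_iff] at hy
        exact hy.le
      exact continuousAt_const.congr this.symm
    · have h1 : ContinuousAt nrm x := hnrmc.continuousAt (isOpen_compl_singleton.mem_nhds hx)
      have h2 : ContinuousAt (fun x => H (τ x, nrm x)) x :=
        H.continuous.continuousAt.comp (hτ.continuousAt.prodMk h1)
      exact (by fun_prop : ContinuousAt (fun x : E => max 1 ‖x‖) x).smul
        (continuous_subtype_val.continuousAt.comp h2)
  have hS : IsClosed {x : E | 2 ≤ ‖x‖} := isClosed_le continuous_const continuous_norm
  have hU : {x : E | 1 < ‖x‖} ∈ nhdsSet {x : E | 2 ≤ ‖x‖} :=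
    (isOpen_lt continuous_const continuous_norm).mem_nhdsSet.2 fun x (hx : 2 ≤ ‖x‖) =>
      show 1 < ‖x‖ by linarith
  -- An error below `1/2` keeps `G` away from `0`, so it can be normalised. Radius `2` leaves a
  -- neighbourhood `‖x‖ > 1` on which `F` is already smooth, so `G` may agree with it exactly for
  -- `‖x‖ ≥ 2`.
  obtain ⟨G, hG, hGF, hGS, -⟩ := hFc.exists_contDiff_approx_and_eqOn 1
    (ε := fun _ => 1 / 2) continuous_const (fun _ => by norm_num) hS hU
    (contDiffOn_id.congr fun x (hx : 1 < ‖x‖) => hFlarge x hx.le)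
  have hG0 : ∀ x, G x ≠ 0 := by
    intro x hx
    have h1 := hGF x
    rw [hx, dist_zero_left] at h1
    linarith [hFnorm x]
  let f : E → E := fun x => (2 * ‖G x‖⁻¹) • G x
  have hf : ContDiff ℝ 1 f :=
    (contDiff_const.mul ((hG.norm ℝ hG0).inv fun x => norm_ne_zero_iff.2 (hG0 x))).smul hG
  have hfn : ∀ x, ‖f x‖ = 2 := by
    intro x
    have := norm_ne_zero_iff.2 (hG0 x)
    rw [norm_smul, norm_mul, norm_inv, norm_norm, Real.norm_two, mul_assoc,
      inv_mul_cancel₀ this, mul_one]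
  have hfr : ∀ x ∈ sphere (0 : E) 2, f x = x := by
    intro x hx
    have hx2 : ‖x‖ = 2 := by simpa using hx
    have h1 : G x = x := (hGS (show 2 ≤ ‖x‖ from hx2.ge)).trans (hFlarge x (by linarith))
    simp [f, h1, hx2]
  have h1 := integral_det_fderiv_eq_volume hf hfr
  simp only [det_fderiv_eq_zero_of_norm_const two_pos (hf.differentiable one_ne_zero) hfn,
    integral_zero] at h1
  have h2 : 0 < volume (closedBall (0 : E) 2) := measure_closedBall_pos _ _ two_pos
  exact (ENNReal.toReal_pos h2.ne' measure_closedBall_lt_top.ne).ne h1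

end NoRetraction

end BicliqueElim

namespace BicliqueElim

open scoped ContinuousMap

/-! ### Homotopy moves on independence complexes. -/

section IndependencePolytope

variable {ι : Type*} [Fintype ι]

/-- The realization of the complex of independent sets of a relation `R`, an element `i` with
`R i i` being regarded as deleted. -/
def indPts (R : ι → ι → Prop) : Set (ι → ℝ) :=
  {x | (∀ i, 0 ≤ x i) ∧ ∑ i, x i = 1 ∧ ∀ i j, x i ≠ 0 → x j ≠ 0 → ¬ R i j}

lemma realization_indComplex (S : SimpleGraph ι) :
    realization (indComplex S) = indPts S.Adj := by
  classical
  ext x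
  constructor
  · rintro ⟨h0, s, ⟨-, hs⟩, hout, hsum⟩
    refine ⟨h0, ?_, fun i j hi hj hij => ?_⟩
    · rw [← hsum]
      exact (Finset.sum_subset (Finset.subset_univ s) fun i _ hi => hout i hi).symm
    · have hi' : i ∈ s := by_contra fun h => hi (hout i h)
      have hj' : j ∈ s := by_contra fun h => hj (hout j h)
      exact hs hi' hj' hij.ne hij
  · rintro ⟨h0, hsum, hR⟩
    refine ⟨h0, Finset.univ.filter (fun i => x i ≠ 0), ⟨?_, ?_⟩, ?_, ?_⟩
    · rw [Finset.nonempty_iff_ne_empty]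
      intro he
      have : ∑ i, x i = 0 := Finset.sum_eq_zero fun i _ => by
        by_contra h
        have : i ∈ Finset.univ.filter (fun i => x i ≠ 0) := by simpa using h
        rw [he] at this
        exact Finset.notMem_empty _ this
      rw [this] at hsum
      exact zero_ne_one hsum
    · intro i hi j hj _
      exact hR i j (by simpa using hi) (by simpa using hj)
    · intro i hi
      simpa using hi
    · rw [← hsum]
      exact Finset.sum_filter_ne_zero _

lemma nonempty_homotopyEquiv_of_retraction {E : Type*} [AddCommGroup E] [Module ℝ E]
    [TopologicalSpace E] [IsTopologicalAddGroup E] [ContinuousSMul ℝ E] {X Y : Set E}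
    (hYX : Y ⊆ X) (r : E → E) (hr : Continuous r) (hrX : ∀ x ∈ X, r x ∈ Y)
    (hrY : ∀ y ∈ Y, r y = y) (hseg : ∀ x ∈ X, segment ℝ (r x) x ⊆ X) : Nonempty (X ≃ₕ Y) := by
  let f : C(X, Y) := ⟨fun x => ⟨r x, hrX x x.2⟩, by fun_prop⟩
  let g : C(Y, X) := ⟨Set.inclusion hYX, continuous_inclusion hYX⟩
  have H : ContinuousMap.Homotopy (g.comp f) (ContinuousMap.id X) :=
    { toFun := fun p => ⟨(1 - (p.1 : ℝ)) • r p.2 + (p.1 : ℝ) • (p.2 : E),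
        hseg p.2 p.2.2 ⟨1 - p.1, p.1, by linarith [p.1.2.2], p.1.2.1, by ring, rfl⟩⟩
      continuous_toFun := by fun_prop
      map_zero_left := fun x => Subtype.ext (by simp [f, g])
      map_one_left := fun x => Subtype.ext (by simp) }
  refine ⟨⟨f, g, ⟨H⟩, ?_⟩⟩
  have : f.comp g = ContinuousMap.id Y := by
    ext y
    exact hrY y y.2
  rw [this]

/-- A self-related index carries no mass, so its other relations do not affect the complex. -/
lemma indPts_congr {R R' : ι → ι → Prop} (h0 : ∀ i, R i i ↔ R' i i)
    (h : ∀ i j, ¬ R i i → ¬ R j j → (R i j ↔ R' i j)) : indPts R = indPts R' := by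
  ext x
  refine and_congr_right fun _ => and_congr_right fun _ => ?_
  constructor
  · intro hx i j hi hj
    rw [← h i j (hx i i hi hi) (hx j j hj hj)]
    exact hx i j hi hj
  · intro hx i j hi hj
    rw [h i j (mt (h0 i).1 (hx i i hi hi)) (mt (h0 j).1 (hx j j hj hj))]
    exact hx i j hi hj

/-- Making one pair `p, q` adjacent does not change the homotopy type if the link of `{p, q}`
is a cone. -/
lemma indPts_insert_pair {R R' : ι → ι → Prop} (p q a : ι) (hRR' : ∀ i j, R i j → R' i j)
    (hpq : R' p q)
    (hR' : ∀ i j, R' i j → R i j ∨ (i = p ∧ j = q) ∨ (i = q ∧ j = p))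
    (hsymm : ∀ ⦃i j⦄, R i j → R j i) (hap : a ≠ p) (haq : a ≠ q) (haa : ¬ R a a)
    (ha : ∀ b, R a b → R b b ∨ R p b ∨ R q b) : Nonempty (indPts R ≃ₕ indPts R') := by
  classical
  -- As a set, this also covers `p = q`, where adding the pair means deleting the vertex `p`.
  let σ : Finset ι := {p, q}
  -- The retraction removes the common mass `t` from `p` and `q` until one of them vanishes, and
  -- gives it to the cone apex `a`. The factor `σ.card` preserves the total mass.
  let t : (ι → ℝ) → ℝ := fun x => min (x p) (x q)
  let r : (ι → ℝ) → (ι → ℝ) := fun x i =>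
    x i - (if i ∈ σ then t x else 0) + (if i = a then σ.card * t x else 0)
  have haσ : a ∉ σ := by simp [σ, hap, haq]
  have ht : Continuous t := by fun_prop
  have hr : Continuous r := by
    refine continuous_pi fun i => ?_
    refine ((continuous_apply i).sub ?_).add ?_ <;> split_ifs <;> fun_prop
  have ht0 : ∀ x ∈ indPts R, 0 ≤ t x := fun x hx => le_min (hx.1 p) (hx.1 q)
  have hr0 : ∀ x ∈ indPts R, ∀ i, 0 ≤ r x i := by
    intro x hx i
    have h1 : 0 ≤ x i - (if i ∈ σ then t x else 0) := by
      split_ifs with h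
      · rw [sub_nonneg]
        simp only [σ, Finset.mem_insert, Finset.mem_singleton] at h
        rcases h with rfl | rfl
        · exact min_le_left _ _
        · exact min_le_right _ _
      · simpa using hx.1 i
    have h2 : 0 ≤ (if i = a then σ.card * t x else 0) := by
      split_ifs
      · exact mul_nonneg (Nat.cast_nonneg _) (ht0 x hx)
      · exact le_rfl
    exact add_nonneg h1 h2
  have hrsum : ∀ x ∈ indPts R, ∑ i, r x i = 1 := by
    intro x hx
    simp only [r, Finset.sum_add_distrib, Finset.sum_sub_distrib, hx.2.1]
    rw [Finset.sum_ite_mem, Finset.univ_inter, Finset.sum_const, Finset.sum_ite_eq' Finset.univ a]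
    simp
  have hrt : ∀ x, t x = 0 → r x = x := by
    intro x hx
    ext i
    simp [r, hx]
  have hrne : ∀ x ∈ indPts R, ∀ i, r x i ≠ 0 → x i ≠ 0 ∨ i = a ∧ t x ≠ 0 := by
    intro x hx i hi
    by_contra! h
    by_cases hta : t x = 0
    · rw [hrt x hta] at hi
      exact hi h.1
    · have hia : i ≠ a := fun hia => hta (h.2 hia)
      apply hi
      refine le_antisymm ?_ (hr0 x hx i)
      simp only [r, hia, if_false, h.1]
      split_ifs
      · linarith [ht0 x hx]
      · simp
  have hcone : ∀ x ∈ indPts R, t x ≠ 0 → ∀ i, x i ≠ 0 → ¬ R a i := by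
    intro x hx htx i hi hai
    have hp : x p ≠ 0 := fun h => htx (le_antisymm (h ▸ min_le_left _ _) (ht0 x hx))
    have hq : x q ≠ 0 := fun h => htx (le_antisymm (h ▸ min_le_right _ _) (ht0 x hx))
    rcases ha i hai with h | h | h
    · exact hx.2.2 i i hi hi h
    · exact hx.2.2 p i hp hi h
    · exact hx.2.2 q i hq hi h
  have hsupp : ∀ x ∈ indPts R, ∀ i j, (x i ≠ 0 ∨ i = a ∧ t x ≠ 0) → (x j ≠ 0 ∨ j = a ∧ t x ≠ 0) →
      ¬ R i j := by
    rintro x hx i j (hi | ⟨rfl, hi⟩) (hj | ⟨rfl, hj⟩)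
    · exact hx.2.2 i j hi hj
    · exact fun h => hcone x hx hj i hi (hsymm h)
    · exact hcone x hx hi j hj
    · exact haa
  refine nonempty_homotopyEquiv_of_retraction (fun x hx => ?_) r hr (fun x hx => ?_)
    (fun x hx => ?_) (fun x hx => ?_)
  · exact ⟨hx.1, hx.2.1, fun i j hi hj h => hx.2.2 i j hi hj (hRR' i j h)⟩
  · refine ⟨hr0 x hx, hrsum x hx, fun i j hi hj hij => ?_⟩
    have hnp : r x p = 0 ∨ r x q = 0 := by
      have h1 : r x p = x p - t x := by simp [r, σ, hap.symm]
      have h2 : r x q = x q - t x := by simp [r, σ, haq.symm]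
      rw [h1, h2]
      rcases min_choice (x p) (x q) with h | h
      · exact Or.inl (by simp [t, h])
      · exact Or.inr (by simp [t, h])
    rcases hR' i j hij with h | ⟨rfl, rfl⟩ | ⟨rfl, rfl⟩
    · exact hsupp x hx i j (hrne x hx i hi) (hrne x hx j hj) h
    · exact hnp.elim hi hj
    · exact hnp.elim hj hi
  · apply hrt
    have : x p = 0 ∨ x q = 0 := by
      by_contra! h
      exact hx.2.2 p q h.1 h.2 hpq
    rcases this with h | h
    · exact (min_eq_left (h ▸ hx.1 q)).trans h
    · exact (min_eq_right (h ▸ hx.1 p)).trans h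
  · rintro _ ⟨c, d, hc, hd, hcd, rfl⟩
    refine ⟨fun i => add_nonneg (mul_nonneg hc (hr0 x hx i)) (mul_nonneg hd (hx.1 i)), ?_, ?_⟩
    · simp only [Pi.add_apply, Pi.smul_apply, smul_eq_mul, Finset.sum_add_distrib,
        ← Finset.mul_sum, hrsum x hx, hx.2.1, mul_one, hcd]
    · have hne : ∀ i, (c • r x + d • x) i ≠ 0 → x i ≠ 0 ∨ i = a ∧ t x ≠ 0 := by
        intro i hi
        by_cases h : r x i = 0
        · left
          rintro h'
          simp [h, h'] at hi
        · exact hrne x hx i h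
      exact fun i j hi hj => hsupp x hx i j (hne i hi) (hne j hj)

/-- Making pairs adjacent does not change the homotopy type if each new pair has a vertex whose
neighbours are deleted or adjacent to a member of the pair. -/
lemma indPts_homotopyEquiv_of_le {R R' : ι → ι → Prop} (hRR' : ∀ i j, R i j → R' i j)
    (hsymm : ∀ ⦃i j⦄, R i j → R j i) (hsymm' : ∀ ⦃i j⦄, R' i j → R' j i)
    (h : ∀ p q, R' p q → ¬ R p q → ∃ a, a ≠ p ∧ a ≠ q ∧ ¬ R' a a ∧
      ∀ b, R' a b → R b b ∨ R p b ∨ R q b) : Nonempty (indPts R ≃ₕ indPts R') := by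
  classical
  induction hn : (Finset.univ.filter fun z : ι × ι => R' z.1 z.2 ∧ ¬ R z.1 z.2).card
    using Nat.strong_induction_on generalizing R with
  | _ n ih =>
    by_cases hex : ∃ p q, R' p q ∧ ¬ R p q
    · obtain ⟨p, q, hpq, hnpq⟩ := hex
      let R₁ : ι → ι → Prop := fun i j => R i j ∨ (i = p ∧ j = q) ∨ (i = q ∧ j = p)
      have hR₁ : ∀ i j, R i j → R₁ i j := fun i j h => Or.inl h
      have hR₁' : ∀ i j, R₁ i j → R' i j := by
        rintro i j (h | ⟨rfl, rfl⟩ | ⟨rfl, rfl⟩)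
        · exact hRR' _ _ h
        · exact hpq
        · exact hsymm' hpq
      have hs₁ : ∀ ⦃i j⦄, R₁ i j → R₁ j i := by
        rintro i j (h | ⟨rfl, rfl⟩ | ⟨rfl, rfl⟩)
        · exact Or.inl (hsymm h)
        · exact Or.inr (Or.inr ⟨rfl, rfl⟩)
        · exact Or.inr (Or.inl ⟨rfl, rfl⟩)
      -- The witness condition compares `R'`-neighbours of `a` with `R`-neighbours of the pair, so
      -- it survives when `R` grows inside `R'`. Pairs can therefore be added one at a time.
      obtain ⟨a, hap, haq, haa, ha⟩ := h p q hpq hnpq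
      obtain ⟨e⟩ := indPts_insert_pair p q a hR₁ (Or.inr (Or.inl ⟨rfl, rfl⟩)) (fun i j h => h)
        hsymm hap haq (fun h => haa (hRR' _ _ h)) (fun b hb => ha b (hRR' _ _ hb))
      obtain ⟨e'⟩ := ih _ (by
        rw [← hn]
        refine Finset.card_lt_card (Finset.ssubset_iff_of_subset ?_ |>.2 ⟨(p, q), ?_, ?_⟩)
        · intro z
          simp only [Finset.mem_filter, Finset.mem_univ, true_and]
          exact fun hz => ⟨hz.1, fun h => hz.2 (hR₁ _ _ h)⟩
        · simpa using ⟨hpq, hnpq⟩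
        · simp [R₁]) hR₁' hs₁ (fun p' q' h1 h2 => by
          obtain ⟨a', h3, h4, h5, h6⟩ := h p' q' h1 fun h => h2 (hR₁ _ _ h)
          refine ⟨a', h3, h4, h5, fun b hb => ?_⟩
          rcases h6 b hb with h | h | h
          · exact Or.inl (hR₁ _ _ h)
          · exact Or.inr (Or.inl (hR₁ _ _ h))
          · exact Or.inr (Or.inr (hR₁ _ _ h))) rfl
      exact ⟨e.trans e'⟩
    · push Not at hex
      have : R = R' := by
        ext i j
        exact ⟨hRR' i j, hex i j⟩
      subst this
      exact ⟨ContinuousMap.HomotopyEquiv.refl _⟩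

/-- A vertex that is adjacent to no vertex is the apex of a cone. -/
lemma contractibleSpace_indPts {R : ι → ι → Prop} (hsymm : ∀ ⦃i j⦄, R i j → R j i) (a : ι) (haa : ¬ R a a)
    (ha : ∀ b, R a b → R b b) : ContractibleSpace (indPts R) := by
  classical
  have hmem : Pi.single a (1 : ℝ) ∈ indPts R := by
    refine ⟨fun i => ?_, by simp, fun i j hi hj => ?_⟩
    · by_cases h : i = a
      · subst h; simp
      · simp [h]
    · have h1 : i = a := by_contra fun h => hi (by simp [h])
      have h2 : j = a := by_contra fun h => hj (by simp [h])
      rwa [h1, h2]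
  refine StarConvex.contractibleSpace (x := Pi.single a (1 : ℝ)) ?_ ⟨_, hmem⟩
  rintro x hx c d hc hd hcd
  refine ⟨fun i => add_nonneg (mul_nonneg hc (hmem.1 i)) (mul_nonneg hd (hx.1 i)), ?_, ?_⟩
  · simp only [Pi.add_apply, Pi.smul_apply, smul_eq_mul, Finset.sum_add_distrib,
      ← Finset.mul_sum, hmem.2.1, hx.2.1, mul_one, hcd]
  · have hne : ∀ i, (c • (Pi.single a 1 : ι → ℝ) + d • x) i ≠ 0 → i = a ∨ x i ≠ 0 := by
      intro i hi
      by_contra! h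
      apply hi
      simp [h.1, h.2]
    have hai : ∀ i, x i ≠ 0 → ¬ R a i := fun i hi h => hx.2.2 i i hi hi (ha i h)
    intro i j hi hj
    rcases hne i hi with h | h <;> rcases hne j hj with h' | h'
    · rwa [h, h']
    · rw [h]; exact hai j h'
    · rw [h']; exact fun hij => hai i h (hsymm hij)
    · exact hx.2.2 i j h h'

/-- The independence complex of a perfect matching is a sphere. -/
lemma nonempty_homeomorph_indPts_sphere {R : ι → ι → Prop} {m : ℕ} (φ : Fin m × Bool → ι)
    (hφ : Function.Injective φ) (hout : ∀ i, i ∉ Set.range φ → R i i)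
    (hR : ∀ p q, R (φ p) (φ q) ↔ p.1 = q.1 ∧ p.2 ≠ q.2) :
    Nonempty (indPts R ≃ₜ Metric.sphere (0 : EuclideanSpace ℝ (Fin m)) 1) := by
  classical
  -- At most one end of each matching edge carries mass, so the difference of the two coordinates
  -- records both. The inverse `G` takes positive and negative parts and rescales by the `ℓ¹` norm
  -- `s`.
  let F : (ι → ℝ) → EuclideanSpace ℝ (Fin m) :=
    fun x => WithLp.toLp 2 fun k => x (φ (k, true)) - x (φ (k, false))
  let s : EuclideanSpace ℝ (Fin m) → ℝ := fun y => ∑ k, |y k|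
  let c : EuclideanSpace ℝ (Fin m) → Fin m × Bool → ℝ :=
    fun y p => (s y)⁻¹ * max (if p.2 then y p.1 else - y p.1) 0
  let G : EuclideanSpace ℝ (Fin m) → (ι → ℝ) := fun y => Function.extend φ (c y) 0
  have hFc : Continuous F := by fun_prop
  have hGφ : ∀ y p, G y (φ p) = c y p := fun y p => hφ.extend_apply _ _ _
  have hGout : ∀ y, ∀ i ∉ Set.range φ, G y i = 0 := fun y i hi =>
    Function.extend_apply' _ _ _ hi
  have hsum : ∀ x : ι → ℝ, (∀ i ∉ Set.range φ, x i = 0) →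
      ∑ i, x i = ∑ k, (x (φ (k, true)) + x (φ (k, false))) := by
    intro x hx
    rw [← Fintype.sum_of_injective φ hφ (fun p => x (φ p)) x hx fun _ => rfl,
      Fintype.sum_prod_type]
    simp
  have hsc : Continuous s := by fun_prop
  have hs0 : ∀ y ≠ 0, 0 < s y := by
    intro y hy
    obtain ⟨k, hk⟩ : ∃ k, y k ≠ 0 := by
      by_contra! h
      exact hy (by ext k; simpa using h k)
    exact Finset.sum_pos' (fun _ _ => abs_nonneg _) ⟨k, Finset.mem_univ _, abs_pos.2 hk⟩
  have habs : ∀ z : ℝ, max z 0 + max (-z) 0 = |z| := by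
    intro z
    rcases le_total 0 z with h | h
    · rw [max_eq_left h, max_eq_right (by linarith), abs_of_nonneg h, add_zero]
    · rw [max_eq_right h, max_eq_left (by linarith), abs_of_nonpos h, zero_add]
  have hdiff : ∀ z : ℝ, max z 0 - max (-z) 0 = z := by
    intro z
    rcases le_total 0 z with h | h
    · rw [max_eq_left h, max_eq_right (by linarith), sub_zero]
    · rw [max_eq_right h, max_eq_left (by linarith)]; ring
  have hGmem : ∀ y ≠ 0, G y ∈ indPts R := by
    intro y hy
    have hsy := hs0 y hy
    refine ⟨fun i => ?_, ?_, fun i j hi hj hij => ?_⟩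
    · by_cases h : i ∈ Set.range φ
      · obtain ⟨p, rfl⟩ := h
        rw [hGφ]
        exact mul_nonneg (inv_nonneg.2 hsy.le) (le_max_right _ _)
      · rw [hGout y i h]
    · rw [hsum _ (hGout y)]
      simp only [hGφ, c, if_true, ← mul_add, habs, ← Finset.mul_sum, Bool.false_eq_true, if_false]
      exact inv_mul_cancel₀ hsy.ne'
    · obtain ⟨p, rfl⟩ : i ∈ Set.range φ := by_contra fun h => hi (hGout y i h)
      obtain ⟨q, rfl⟩ : j ∈ Set.range φ := by_contra fun h => hj (hGout y j h)
      obtain ⟨h1, h2⟩ := (hR p q).1 hij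
      rw [hGφ] at hi hj
      obtain ⟨k, b⟩ := p
      obtain ⟨k', b'⟩ := q
      obtain rfl : k = k' := h1
      have h3 : ∀ z : ℝ, max z 0 ≠ 0 → 0 < z := fun z hz => by
        by_contra! h
        exact hz (max_eq_right h)
      have hi' := h3 _ (right_ne_zero_of_mul hi)
      have hj' := h3 _ (right_ne_zero_of_mul hj)
      cases b <;> cases b' <;> simp at h2 hi' hj' <;> linarith
  have hxout : ∀ x ∈ indPts R, ∀ i ∉ Set.range φ, x i = 0 := fun x hx i hi => by
    by_contra h
    exact hx.2.2 i i h h (hout i hi)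
  have hx01 : ∀ x ∈ indPts R, ∀ k, x (φ (k, true)) = 0 ∨ x (φ (k, false)) = 0 := by
    intro x hx k
    by_contra! h
    exact hx.2.2 _ _ h.1 h.2 ((hR _ _).2 ⟨rfl, by simp⟩)
  have hsF : ∀ x ∈ indPts R, s (F x) = 1 := by
    intro x hx
    rw [← hx.2.1, hsum x (hxout x hx)]
    refine Finset.sum_congr rfl fun k _ => ?_
    change |x (φ (k, true)) - x (φ (k, false))| = _
    rcases hx01 x hx k with h | h
    · simp [h, abs_of_nonneg (hx.1 _)]
    · simp [h, abs_of_nonneg (hx.1 _)]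
  have hF0 : ∀ x ∈ indPts R, F x ≠ 0 := by
    intro x hx h
    have := hsF x hx
    rw [h] at this
    simp [s] at this
  have hGF : ∀ x ∈ indPts R, G (‖F x‖⁻¹ • F x) = x := by
    intro x hx
    have hn : 0 < ‖F x‖⁻¹ := inv_pos.2 (norm_pos_iff.2 (hF0 x hx))
    have hs : s (‖F x‖⁻¹ • F x) = ‖F x‖⁻¹ := by
      have : s (‖F x‖⁻¹ • F x) = ‖F x‖⁻¹ * s (F x) := by
        simp only [s, PiLp.smul_apply, smul_eq_mul, abs_mul, abs_of_pos hn, Finset.mul_sum]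
      rw [this, hsF x hx, mul_one]
    ext i
    by_cases h : i ∈ Set.range φ
    · obtain ⟨⟨k, b⟩, rfl⟩ := h
      rw [hGφ]
      have hmax : ∀ z : ℝ, (‖F x‖⁻¹)⁻¹ * max (‖F x‖⁻¹ * z) 0 = max z 0 := by
        intro z
        rw [mul_max_of_nonneg _ _ (inv_pos.2 hn).le, mul_zero, inv_mul_cancel_left₀ hn.ne']
      have hk : (F x) k = x (φ (k, true)) - x (φ (k, false)) := rfl
      have h1 := hx.1 (φ (k, true))
      have h2 := hx.1 (φ (k, false))
      cases b
      · simp only [c, hs, PiLp.smul_apply, smul_eq_mul, Bool.false_eq_true, if_false, ← mul_neg]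
        rw [hmax, hk]
        rcases hx01 x hx k with h | h
        · rw [h]; simpa using h2
        · rw [h]; simpa using h1
      · simp only [c, hs, PiLp.smul_apply, smul_eq_mul, if_true]
        rw [hmax, hk]
        rcases hx01 x hx k with h | h
        · rw [h]; simpa using h2
        · rw [h]; simpa using h1
    · rw [hGout _ i h, hxout x hx i h]
  have hFG : ∀ y ≠ 0, F (G y) = (s y)⁻¹ • y := by
    intro y hy
    ext k
    change G y (φ (k, true)) - G y (φ (k, false)) = (s y)⁻¹ * y k
    simp only [hGφ, c, if_true, Bool.false_eq_true, if_false, ← mul_sub, hdiff]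
  have hy0 : ∀ y : Metric.sphere (0 : EuclideanSpace ℝ (Fin m)) 1,
      (y : EuclideanSpace ℝ (Fin m)) ≠ 0 := fun y h => by
    have := norm_eq_of_mem_sphere y
    rw [h, norm_zero] at this
    exact zero_ne_one this
  refine ⟨{ toFun := fun x => ⟨‖F x‖⁻¹ • F x, ?_⟩
            invFun := fun y => ⟨G y, hGmem y (hy0 y)⟩
            left_inv := fun x => Subtype.ext (hGF x x.2)
            right_inv := fun y => Subtype.ext ?_
            continuous_toFun := ?_
            continuous_invFun := ?_ }⟩
  · rw [mem_sphere_zero_iff_norm, norm_smul, norm_inv, norm_norm,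
      inv_mul_cancel₀ (norm_ne_zero_iff.2 (hF0 x x.2))]
  · change ‖F (G y)‖⁻¹ • F (G y) = y
    have hsy := hs0 y (hy0 y)
    rw [hFG y (hy0 y), norm_smul, norm_eq_of_mem_sphere, mul_one, smul_smul, norm_inv,
      Real.norm_of_nonneg hsy.le, inv_inv, mul_inv_cancel₀ hsy.ne', one_smul]
  · have hFx : Continuous fun x : indPts R => F x := hFc.comp continuous_subtype_val
    exact ((hFx.norm.inv₀ fun x => norm_ne_zero_iff.2 (hF0 x x.2)).smul hFx).subtype_mk _
  · refine Continuous.subtype_mk (continuous_pi fun i => ?_) _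
    by_cases h : i ∈ Set.range φ
    · obtain ⟨⟨k, b⟩, rfl⟩ := h
      simp only [hGφ, c]
      refine Continuous.mul (Continuous.inv₀ (by fun_prop) fun y => (hs0 y (hy0 y)).ne') ?_
      cases b <;> simp only [if_true, Bool.false_eq_true, if_false] <;> fun_prop
    · simp only [hGout _ i h]
      exact continuous_const

end IndependencePolytope

end BicliqueElim

namespace BicliqueElim

/-! ### Confluence of bisimplicial eliminations. -/

section Elimination

variable {V : Type*} {G : SimpleGraph V}

/-- The vertices of `G[A]` left after deleting the closed neighbourhood of the edge `uv`. -/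
def remaining (G : SimpleGraph V) (A : Set V) (u v : V) : Set V :=
  {w | w ∈ A ∧ ¬ G.Adj u w ∧ ¬ G.Adj v w}

/-- `uv` is an edge of `G[A]` such that every neighbour of `u` is adjacent to every
neighbour of `v`. -/
def IsBisimplicialPair (G : SimpleGraph V) (A : Set V) (u v : V) : Prop :=
  u ∈ A ∧ v ∈ A ∧ G.Adj u v ∧ ∀ a ∈ A, ∀ b ∈ A, G.Adj u a → G.Adj v b → G.Adj a b

/-- `G[A]` can be reduced to the empty graph by `k` eliminations. -/
inductive Reducible (G : SimpleGraph V) : ℕ → Set V → Prop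
  | empty : Reducible G 0 ∅
  | step {k : ℕ} {A : Set V} {u v : V} :
      IsBisimplicialPair G A u v → Reducible G k (remaining G A u v) → Reducible G (k + 1) A

lemma remaining_comm (A : Set V) (u v : V) : remaining G A u v = remaining G A v u := by
  ext w
  exact and_congr_right fun _ => and_comm

lemma IsBisimplicialPair.symm {A : Set V} {u v : V} (h : IsBisimplicialPair G A u v) :
    IsBisimplicialPair G A v u :=
  ⟨h.2.1, h.1, h.2.2.1.symm, fun a ha b hb hva hub => (h.2.2.2 b hb a ha hub hva).symm⟩

lemma Reducible.exists_adj {k : ℕ} {A : Set V} (h : Reducible G k A) :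
    ∀ x ∈ A, ∃ y ∈ A, G.Adj x y := by
  induction h with
  | empty => exact fun x hx => hx.elim
  | @step k A u v hb _ ih =>
    intro x hx
    by_cases h1 : G.Adj u x
    · exact ⟨u, hb.1, h1.symm⟩
    by_cases h2 : G.Adj v x
    · exact ⟨v, hb.2.1, h2.symm⟩
    obtain ⟨y, hy, hxy⟩ := ih x ⟨hx, h1, h2⟩
    exact ⟨y, hy.1, hxy⟩

/-- If `u` and `y` are adjacent, bisimpliciality of both pairs makes the neighbourhoods in `A`
agree: `N(u) = N(x)` and `N(v) = N(y)`. Otherwise `y` survives the deletion at `uv`. A surviving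
neighbour `z` of `y` would then be adjacent to `v`, because `v` is a neighbour of `x`; this
contradicts its survival. -/
lemma remaining_eq_of_adj {A : Set V} {u v x y : V} (he : IsBisimplicialPair G A u v)
    (hf : IsBisimplicialPair G A x y) (hvx : G.Adj v x)
    (hadj : ∀ a ∈ remaining G A u v, ∃ b ∈ remaining G A u v, G.Adj a b) :
    remaining G A u v = remaining G A x y := by
  obtain ⟨hu, hv, -, he⟩ := he
  obtain ⟨hx, hy, -, hf⟩ := hf
  by_cases huy : G.Adj u y
  · ext w
    refine and_congr_right fun hw => and_congr (not_congr ⟨fun h => ?_, fun h => ?_⟩)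
      (not_congr ⟨fun h => ?_, fun h => ?_⟩)
    · exact (he w hw x hx h hvx).symm
    · exact (hf w hw u hu h huy.symm).symm
    · exact he y hy w hw huy h
    · exact hf v hv w hw hvx.symm h
  · have hvy : ¬ G.Adj v y := fun h => G.loopless.irrefl v (hf v hv v hv hvx.symm h.symm)
    obtain ⟨z, hz, hyz⟩ := hadj y ⟨hy, huy, hvy⟩
    exact absurd (hf v hv z hz.1 hvx.symm hyz) hz.2.2

lemma IsBisimplicialPair.mono {A A' : Set V} (hA : A' ⊆ A) {u v : V}
    (h : IsBisimplicialPair G A u v) (hu : u ∈ A') (hv : v ∈ A') :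
    IsBisimplicialPair G A' u v :=
  ⟨hu, hv, h.2.2.1, fun a ha b hb => h.2.2.2 a (hA ha) b (hA hb)⟩

/-- Any elimination step can be the first one of a reduction to the empty graph. -/
lemma Reducible.exists_remaining {k : ℕ} {A : Set V} (h : Reducible G k A) {x y : V}
    (hf : IsBisimplicialPair G A x y) :
    ∃ k', k = k' + 1 ∧ Reducible G k' (remaining G A x y) := by
  induction h with
  | empty => exact hf.1.elim
  | @step k A u v he hr ih =>
    have hadj := hr.exists_adj
    have hadj' : ∀ a ∈ remaining G A v u, ∃ b ∈ remaining G A v u, G.Adj a b := by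
      rwa [remaining_comm]
    by_cases h1 : G.Adj v x
    · exact ⟨k, rfl, remaining_eq_of_adj he hf h1 hadj ▸ hr⟩
    by_cases h2 : G.Adj u x
    · exact ⟨k, rfl, remaining_eq_of_adj he.symm hf h2 hadj' ▸ remaining_comm A u v ▸ hr⟩
    by_cases h3 : G.Adj v y
    · exact ⟨k, rfl, remaining_comm A x y ▸ remaining_eq_of_adj he hf.symm h3 hadj ▸ hr⟩
    by_cases h4 : G.Adj u y
    · exact ⟨k, rfl, remaining_comm A x y ▸ remaining_eq_of_adj he.symm hf.symm h4 hadj' ▸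
        remaining_comm A u v ▸ hr⟩
    -- With no adjacency between the two pairs, `xy` survives the deletion at `uv` and conversely,
    -- so the two steps can be interchanged.
    obtain ⟨k', rfl, hk'⟩ := ih (hf.mono (fun _ h => h.1) ⟨hf.1, h2, h1⟩ ⟨hf.2.1, h4, h3⟩)
    refine ⟨k' + 1, rfl, .step (u := u) (v := v) (he.mono (fun _ h => h.1)
      ⟨he.1, fun h => h2 h.symm, fun h => h4 h.symm⟩
      ⟨he.2.1, fun h => h1 h.symm, fun h => h3 h.symm⟩) ?_⟩
    convert hk' using 1
    ext w
    simp only [remaining, Set.mem_ofPred_eq]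
    tauto

lemma Reducible.eq_empty {k : ℕ} {A : Set V} (h : Reducible G k A)
    (hA : ∀ x ∈ A, ∀ y ∈ A, ¬ G.Adj x y) : k = 0 ∧ A = ∅ := by
  cases h with
  | empty => exact ⟨rfl, rfl⟩
  | step he _ => exact absurd he.2.2.1 (hA _ he.1 _ he.2.1)

lemma elimGraph_succ {E : List (Sym2 V)} {i : ℕ} (hi : i < E.length) :
    elimGraph G E (i + 1) = elimStep (elimGraph G E i) E[i] := by
  rw [elimGraph, elimGraph, List.take_succ_eq_append_getElem hi, List.foldl_append]
  rfl

lemma elimGraph_adj {E : List (Sym2 V)} (i : ℕ) (x y : V) :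
    (elimGraph G E i).Adj x y ↔
      x ∈ (elimGraph G E i).verts ∧ y ∈ (elimGraph G E i).verts ∧ G.Adj x y := by
  induction i with
  | zero => simp [elimGraph]
  | succ i ih =>
    by_cases hi : i < E.length
    · rw [elimGraph_succ hi]
      simp only [elimStep, SimpleGraph.Subgraph.deleteVerts_adj,
        SimpleGraph.Subgraph.deleteVerts_verts, Set.mem_sdiff, ih]
      tauto
    · have h1 : elimGraph G E (i + 1) = elimGraph G E i := by
        rw [elimGraph, elimGraph, List.take_of_length_le (by omega),
          List.take_of_length_le (by omega)]
      rw [h1]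
      exact ih

/-- In a biclique, `a` lies on the side of `v` and `b` on the side of `u`, which are opposite sides.
-/
lemma adj_of_isBiclique {H : G.Subgraph} {S : Set V} (hS : IsBiclique (H.induce S).coe)
    {u v a b : V} (hu : u ∈ S) (hv : v ∈ S) (ha : a ∈ S) (hb : b ∈ S) (huv : H.Adj u v)
    (hua : H.Adj u a) (hvb : H.Adj v b) : H.Adj a b := by
  obtain ⟨p, q, -, -, ⟨φ⟩⟩ := hS
  have key : ∀ (x y : V) (hx : x ∈ S) (hy : y ∈ S), H.Adj x y ↔
      (completeBipartiteGraph (Fin p) (Fin q)).Adj (φ ⟨x, hx⟩) (φ ⟨y, hy⟩) := by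
    intro x y hx hy
    rw [φ.map_adj_iff]
    simp [hx, hy]
  rw [key _ _ hu hv] at huv
  rw [key _ _ hu ha] at hua
  rw [key _ _ hv hb] at hvb
  rw [key _ _ ha hb]
  simp only [completeBipartiteGraph_adj] at *
  generalize φ ⟨u, hu⟩ = u' at *
  generalize φ ⟨v, hv⟩ = v' at *
  generalize φ ⟨a, ha⟩ = a' at *
  generalize φ ⟨b, hb⟩ = b' at *
  rcases u' with _ | _ <;> rcases v' with _ | _ <;> rcases a' with _ | _ <;>
    rcases b' with _ | _ <;> simp_all

lemma IsBisimplicialEdge.exists_pair {H : G.Subgraph} (hH : ∀ x y, H.Adj x y ↔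
      x ∈ H.verts ∧ y ∈ H.verts ∧ G.Adj x y) {e : Sym2 V} (he : IsBisimplicialEdge H e) :
    ∃ u v, IsBisimplicialPair G H.verts u v ∧
      (elimStep H e).verts = remaining G H.verts u v := by
  induction e using Sym2.ind with
  | _ u v =>
    obtain ⟨hadj, hbi⟩ := he
    rw [SimpleGraph.Subgraph.mem_edgeSet] at hadj
    have huv := (hH u v).1 hadj
    have hmem : ∀ w, w ∈ edgeNbhd H s(u, v) ↔ H.Adj u w ∨ H.Adj v w := by
      intro w
      simp only [edgeNbhd, Set.mem_ofPred_eq, Sym2.mem_iff, exists_eq_or_imp, exists_eq_left]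
      constructor
      · rintro ((rfl | h) | (rfl | h))
        · exact Or.inr hadj.symm
        · exact Or.inl h
        · exact Or.inl hadj
        · exact Or.inr h
      · rintro (h | h)
        · exact Or.inl (Or.inr h)
        · exact Or.inr (Or.inr h)
    refine ⟨u, v, ⟨huv.1, huv.2.1, huv.2.2, fun a ha b hb hua hvb => ?_⟩, ?_⟩
    · have hua' := (hH u a).2 ⟨huv.1, ha, hua⟩
      have hvb' := (hH v b).2 ⟨huv.2.1, hb, hvb⟩
      exact ((hH a b).1 (adj_of_isBiclique hbi ((hmem u).2 (Or.inr hadj.symm))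
        ((hmem v).2 (Or.inl hadj)) ((hmem a).2 (Or.inl hua')) ((hmem b).2 (Or.inr hvb'))
        hadj hua' hvb')).2.2
    · ext w
      simp only [elimStep, SimpleGraph.Subgraph.deleteVerts_verts, Set.mem_sdiff, hmem, hH,
        remaining, Set.mem_ofPred_eq, huv.1, huv.2.1]
      tauto

lemma IsElimSeq.exists_pair {E : List (Sym2 V)} (hE : IsElimSeq G E) {i : ℕ}
    (hi : i < E.length) : ∃ u v, IsBisimplicialPair G (elimGraph G E i).verts u v ∧
      (elimGraph G E (i + 1)).verts = remaining G (elimGraph G E i).verts u v := by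
  rw [elimGraph_succ hi]
  exact (hE.bisimplicial i hi).exists_pair (elimGraph_adj i)

lemma IsElimSeq.not_adj {E : List (Sym2 V)} (hE : IsElimSeq G E) :
    ∀ x ∈ (elimGraph G E E.length).verts, ∀ y ∈ (elimGraph G E E.length).verts,
      ¬ G.Adj x y := by
  intro x hx y hy hxy
  have : s(x, y) ∈ (elimGraph G E E.length).edgeSet :=
    SimpleGraph.Subgraph.mem_edgeSet.2 ((elimGraph_adj _ x y).2 ⟨hx, hy, hxy⟩)
  rw [hE.edgeless] at this
  exact this

/-- The final graph has no edges, so all its vertices are isolated after the last step and belong to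
`isoSeq`. -/
lemma IsElimSeq.verts_eq_empty {E : List (Sym2 V)} (hE : IsElimSeq G E)
    (hiso : isoSeq G E = ∅) : (elimGraph G E E.length).verts = ∅ := by
  have hpos : 0 < E.length := List.length_pos_of_ne_nil hE.ne_nil
  obtain ⟨n, hn⟩ : ∃ n, E.length = n + 1 := ⟨E.length - 1, by omega⟩
  have hlt : n < E.length := by omega
  rw [Set.eq_empty_iff_forall_notMem]
  intro x hx
  have : x ∈ isoSeq G E := by
    simp only [isoSeq, Set.mem_iUnion]
    refine ⟨n, hlt, ?_⟩
    rw [iso, ← elimGraph_succ hlt, ← hn]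
    refine ⟨hx, fun w hw => ?_⟩
    have := (elimGraph_adj _ _ _).1 hw
    exact hE.not_adj x hx w this.2.1 this.2.2
  rw [hiso] at this
  exact this

lemma isoSeq_eq_empty {E : List (Sym2 V)}
    (h : ∀ i < E.length, ∃ k, Reducible G k (elimGraph G E (i + 1)).verts) :
    isoSeq G E = ∅ := by
  rw [Set.eq_empty_iff_forall_notMem]
  intro x hx
  simp only [isoSeq, Set.mem_iUnion] at hx
  obtain ⟨i, hi, hx⟩ := hx
  rw [iso, ← elimGraph_succ hi] at hx
  obtain ⟨k, hk⟩ := h i hi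
  obtain ⟨y, hy, hxy⟩ := hk.exists_adj x hx.1
  exact hx.2 y ((elimGraph_adj _ _ _).2 ⟨hx.1, hy, hxy⟩)

lemma IsElimSeq.reducible {E : List (Sym2 V)} (hE : IsElimSeq G E)
    (h : (elimGraph G E E.length).verts = ∅) {i j : ℕ} (hij : i + j = E.length) :
    Reducible G j (elimGraph G E i).verts := by
  induction j generalizing i with
  | zero =>
    obtain rfl : i = E.length := hij
    rw [h]
    exact .empty
  | succ j ih =>
    obtain ⟨u, v, hb, hv⟩ := hE.exists_pair (i := i) (by omega)
    exact .step hb (hv ▸ ih (by omega))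

lemma IsElimSeq.isoSeq_eq_empty {E : List (Sym2 V)} (hE : IsElimSeq G E)
    (h : (elimGraph G E E.length).verts = ∅) : isoSeq G E = ∅ :=
  BicliqueElim.isoSeq_eq_empty fun i hi =>
    ⟨E.length - (i + 1), hE.reducible h (by omega)⟩

/-- Confluence is applied at each step of `F`: reducibility persists and every step lowers the count
by one. -/
lemma Reducible.of_isElimSeq {k : ℕ} {F : List (Sym2 V)} (hF : IsElimSeq G F)
    (h : Reducible G k Set.univ) {i : ℕ} (hi : i ≤ F.length) :
    ∃ j, k = i + j ∧ Reducible G j (elimGraph G F i).verts := by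
  induction i with
  | zero => exact ⟨k, (zero_add k).symm, by simpa [elimGraph] using h⟩
  | succ i ih =>
    obtain ⟨j, hj, hr⟩ := ih (by omega)
    obtain ⟨u, v, hb, hv⟩ := hF.exists_pair (i := i) hi
    obtain ⟨j', rfl, hr'⟩ := hr.exists_remaining hb
    exact ⟨j', by omega, hv ▸ hr'⟩

/-- If a graph admits a complete elimination sequence, then all of its elimination sequences
are complete and have the same length. -/
lemma IsElimSeq.isoSeq_eq_empty_and_length_eq {E F : List (Sym2 V)} (hE : IsElimSeq G E)
    (hiso : isoSeq G E = ∅) (hF : IsElimSeq G F) : isoSeq G F = ∅ ∧ F.length = E.length := by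
  have hred : Reducible G E.length Set.univ := by
    simpa [elimGraph] using
      hE.reducible (hE.verts_eq_empty hiso) (i := 0) (j := E.length) (zero_add _)
  obtain ⟨j, hj, hr⟩ := hred.of_isElimSeq hF le_rfl
  obtain ⟨rfl, hempty⟩ := hr.eq_empty hF.not_adj
  exact ⟨hF.isoSeq_eq_empty hempty, hj.symm⟩

end Elimination

end BicliqueElim

namespace BicliqueElim

open scoped ContinuousMap

/-! ### Splitting the subdivision graph into a matching. -/

section Subdivision

variable {V : Type*} {G : SimpleGraph V}

/-- The edge `e` lies in `G[A]`. -/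
def EdgeIn (A : Set V) (e : G.edgeSet) : Prop := ∀ y ∈ (e : Sym2 V), y ∈ A

/-- Incidence in the disjoint union of `S(G[A])` and the matching `M`. -/
def Incident (A : Set V) (M : Set (V × G.edgeSet)) (x : V) (e : G.edgeSet) : Prop :=
  (x ∈ (e : Sym2 V) ∧ EdgeIn A e) ∨ (x, e) ∈ M

/-- The disjoint union of `S(G[A])` and the matching `M`, on the vertices of `S(G)`; the other
vertices are related to themselves. -/
def splitRel (A : Set V) (M : Set (V × G.edgeSet)) : V ⊕ G.edgeSet → V ⊕ G.edgeSet → Prop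
  | .inl x, .inl y => x = y ∧ x ∉ A ∧ ∀ e, (x, e) ∉ M
  | .inl x, .inr e => Incident A M x e
  | .inr e, .inl x => Incident A M x e
  | .inr e, .inr f => e = f ∧ ¬ EdgeIn A e ∧ ∀ x, (x, e) ∉ M

/-- `M` is a matching outside `S(G[A])`. -/
structure IsSplit (A : Set V) (M : Set (V × G.edgeSet)) : Prop where
  notMem : ∀ x e, (x, e) ∈ M → x ∉ A
  not_edgeIn : ∀ x e, (x, e) ∈ M → ¬ EdgeIn A e
  inj_left : ∀ x e f, (x, e) ∈ M → (x, f) ∈ M → e = f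
  inj_right : ∀ x y e, (x, e) ∈ M → (y, e) ∈ M → x = y

lemma splitRel_symm (A : Set V) (M : Set (V × G.edgeSet)) :
    ∀ ⦃i j⦄, splitRel A M i j → splitRel A M j i := by
  rintro (x | e) (y | f) h
  · obtain ⟨rfl, h⟩ := h; exact ⟨rfl, h⟩
  · exact h
  · exact h
  · obtain ⟨rfl, h⟩ := h; exact ⟨rfl, h⟩

lemma IsSplit.splitRel_inl_iff {A : Set V} {M : Set (V × G.edgeSet)} (hM : IsSplit A M) {x : V}
    (hx : x ∈ A) (b : V ⊕ G.edgeSet) : splitRel A M (.inl x) b ↔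
      ∃ y, ∃ h : G.Adj x y, y ∈ A ∧ b = .inr ⟨s(x, y), h⟩ := by
  rcases b with y | ⟨e, he⟩
  · simp only [splitRel, hx, not_true_eq_false, false_and, and_false, false_iff]
    rintro ⟨y, _, -, h⟩
    cases h
  · constructor
    · rintro (⟨h1, h2⟩ | h)
      · obtain ⟨y, rfl⟩ := h1
        exact ⟨y, he, h2 y (by simp), rfl⟩
      · exact absurd hx (hM.notMem _ _ h)
    · rintro ⟨y, hy, hyA, h⟩
      cases h
      refine Or.inl ⟨by simp, fun z hz => ?_⟩
      rcases Sym2.mem_iff.1 hz with rfl | rfl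
      · exact hx
      · exact hyA

lemma IsSplit.splitRel_inr_iff {A : Set V} {M : Set (V × G.edgeSet)} (hM : IsSplit A M)
    {x y : V} (h : G.Adj x y) (hx : x ∈ A) (hy : y ∈ A) (b : V ⊕ G.edgeSet) :
    splitRel A M (.inr ⟨s(x, y), h⟩) b ↔ b = .inl x ∨ b = .inl y := by
  have hin : EdgeIn A (⟨s(x, y), h⟩ : G.edgeSet) := fun z hz => by
    rcases Sym2.mem_iff.1 hz with rfl | rfl <;> assumption
  rcases b with z | e
  · simp only [splitRel, Incident, hin, and_true, Sym2.mem_iff, Sum.inl.injEq]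
    exact ⟨fun h' => h'.elim id fun h' => absurd hin (hM.not_edgeIn _ _ h'), Or.inl⟩
  · simp [splitRel, hin]

/-- The new pair comes from inside `S(G[A])`, which the old matching does not touch. -/
lemma IsSplit.isSplit_insert {A A' : Set V} {M : Set (V × G.edgeSet)} (hM : IsSplit A M)
    (hA : A' ⊆ A) {w : V} {e₁ : G.edgeSet} (hw : w ∈ A) (hw' : w ∉ A') (he : EdgeIn A e₁)
    (he' : ¬ EdgeIn A' e₁) : IsSplit A' (insert (w, e₁) M) := by
  refine ⟨?_, ?_, ?_, ?_⟩
  · rintro x e (h | h)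
    · rw [Prod.mk.injEq] at h
      exact h.1 ▸ hw'
    · exact fun h' => hM.notMem x e h (hA h')
  · rintro x e (h | h)
    · rw [Prod.mk.injEq] at h
      exact h.2 ▸ he'
    · exact fun h' => hM.not_edgeIn x e h fun y hy => hA (h' y hy)
  · rintro x e f (h | h) (h' | h')
    · rw [Prod.mk.injEq] at h h'
      exact h.2.trans h'.2.symm
    · rw [Prod.mk.injEq] at h
      exact absurd hw (h.1 ▸ hM.notMem _ _ h')
    · rw [Prod.mk.injEq] at h'
      exact absurd hw (h'.1 ▸ hM.notMem _ _ h)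
    · exact hM.inj_left x e f h h'
  · rintro x y e (h | h) (h' | h')
    · rw [Prod.mk.injEq] at h h'
      exact h.1.trans h'.1.symm
    · rw [Prod.mk.injEq] at h
      exact absurd he (h.2 ▸ hM.not_edgeIn _ _ h')
    · rw [Prod.mk.injEq] at h'
      exact absurd he (h'.2 ▸ hM.not_edgeIn _ _ h)
    · exact hM.inj_right x y e h h'

/-- Moving the edge from `w` to `e` out of `S(G[A])` if the vertex `w` dominates `v`. -/
lemma IsSplit.exists_homotopyEquiv_of_dominated [Fintype (V ⊕ G.edgeSet)]
    {A : Set V} {M : Set (V × G.edgeSet)} (hM : IsSplit A M) {v w z₀ : V} (hv : v ∈ A)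
    (hw : w ∈ A) (hvw : v ≠ w) (hdom : ∀ z ∈ A, G.Adj v z → G.Adj w z) (hz₀ : z₀ ∈ A)
    (hvz₀ : G.Adj v z₀) : ∃ M', M ⊆ M' ∧ M'.Nonempty ∧ IsSplit (A \ {w}) M' ∧
      Nonempty (indPts (splitRel A M) ≃ₕ indPts (splitRel (A \ {w}) M')) := by
  have hnvw : ¬ G.Adj v w := fun h => G.loopless.irrefl w (hdom w hw h)
  have hwz₀ : G.Adj w z₀ := hdom z₀ hz₀ hvz₀
  set e₁ : G.edgeSet := ⟨s(w, z₀), hwz₀⟩ with he₁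
  have he₁in : EdgeIn A e₁ := fun y hy => by
    rcases Sym2.mem_iff.1 hy with rfl | rfl <;> assumption
  let T : V ⊕ G.edgeSet → Prop := fun a =>
    ∃ z, ∃ h : G.Adj v z, z ∈ A ∧ z ≠ z₀ ∧ a = .inr ⟨s(v, z), h⟩
  let U : V ⊕ G.edgeSet → Prop := fun a =>
    ∃ z, ∃ h : G.Adj w z, z ∈ A ∧ z ≠ z₀ ∧ a = .inr ⟨s(w, z), h⟩
  let del : V ⊕ G.edgeSet → V ⊕ G.edgeSet → Prop := fun a b =>
    (a = .inr e₁ ∧ b = .inl z₀) ∨ (a = .inl z₀ ∧ b = .inr e₁)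
  -- The aim is to cut `e₁ = wz₀` from `z₀`. Joining `e₁` to the other edges at `v` gives `R₁`,
  -- dropping the pair `e₁, z₀` gives `R₂`, and undoing the joins gives `R₃`. Now `w` is the only
  -- neighbour of `e₁`, so the other edges at `w` can be deleted, giving `R₄`, in which `w` and `e₁`
  -- form an isolated edge.
  let R₀ := splitRel A M
  let R₁ : V ⊕ G.edgeSet → V ⊕ G.edgeSet → Prop := fun a b =>
    R₀ a b ∨ (a = .inr e₁ ∧ T b) ∨ (T a ∧ b = .inr e₁)
  let R₂ : V ⊕ G.edgeSet → V ⊕ G.edgeSet → Prop := fun a b => R₁ a b ∧ ¬ del a b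
  let R₃ : V ⊕ G.edgeSet → V ⊕ G.edgeSet → Prop := fun a b => R₀ a b ∧ ¬ del a b
  let R₄ : V ⊕ G.edgeSet → V ⊕ G.edgeSet → Prop := fun a b => R₃ a b ∨ (a = b ∧ U a)
  have s₀ : ∀ ⦃i j⦄, R₀ i j → R₀ j i := splitRel_symm A M
  have sdel : ∀ i j, del i j → del j i := fun i j h => h.elim (fun h => Or.inr ⟨h.2, h.1⟩)
    fun h => Or.inl ⟨h.2, h.1⟩
  have s₁ : ∀ ⦃i j⦄, R₁ i j → R₁ j i := by
    rintro i j (h | h | h)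
    · exact Or.inl (s₀ h)
    · exact Or.inr (Or.inr h.symm)
    · exact Or.inr (Or.inl h.symm)
  have s₂ : ∀ ⦃i j⦄, R₂ i j → R₂ j i := fun i j h => ⟨s₁ h.1, fun h' => h.2 (sdel _ _ h')⟩
  have s₃ : ∀ ⦃i j⦄, R₃ i j → R₃ j i := fun i j h => ⟨s₀ h.1, fun h' => h.2 (sdel _ _ h')⟩
  have s₄ : ∀ ⦃i j⦄, R₄ i j → R₄ j i := by
    rintro i j (h | ⟨rfl, h⟩)
    · exact Or.inl (s₃ h)
    · exact Or.inr ⟨rfl, h⟩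
  have hne_vz : ∀ z (h : G.Adj v z), (⟨s(v, z), h⟩ : G.edgeSet) ≠ e₁ := by
    intro z h h'
    have h' := Sym2.eq_iff.1 (Subtype.ext_iff.1 h')
    rcases h' with h' | h'
    · exact hvw h'.1
    · exact hnvw (h'.2 ▸ h)
  have hne_wz : ∀ z (h : G.Adj w z), z ≠ z₀ → (⟨s(w, z), h⟩ : G.edgeSet) ≠ e₁ := by
    intro z h hz h'
    have h' := Sym2.eq_iff.1 (Subtype.ext_iff.1 h')
    rcases h' with h' | h'
    · exact hz h'.2
    · exact hz (h'.2.trans h'.1)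
  have hwzT : ∀ z (h : G.Adj w z), ¬ T (.inr ⟨s(w, z), h⟩) := by
    rintro z h ⟨z', hz', -, -, h'⟩
    have h' := Sym2.eq_iff.1 (Subtype.ext_iff.1 (Sum.inr_injective h'))
    rcases h' with h' | h'
    · exact hvw h'.1.symm
    · exact hnvw (h'.1 ▸ hz')
  have hinlT : ∀ x, ¬ T (.inl x) := by
    rintro x ⟨_, _, _, _, h⟩
    cases h
  have hR₁wz : ∀ z (h : G.Adj w z), z ∈ A → z ≠ z₀ → ∀ b, R₁ (.inr ⟨s(w, z), h⟩) b →
      b = .inl w ∨ b = .inl z := by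
    rintro z h hz hzz b (h' | ⟨h', -⟩ | ⟨h', -⟩)
    · exact (hM.splitRel_inr_iff h hw hz b).1 h'
    · exact absurd (Sum.inr_injective h') (hne_wz z h hzz)
    · exact absurd h' (hwzT z h)
  have hR₃w : R₃ (.inr e₁) (.inl w) := by
    refine ⟨(hM.splitRel_inr_iff hwz₀ hw hz₀ _).2 (Or.inl rfl), ?_⟩
    rintro (⟨-, h⟩ | ⟨h, -⟩)
    · exact hwz₀.ne (Sum.inl_injective h)
    · cases h
  have hR₃vz : ∀ z (h : G.Adj v z), z ∈ A → R₃ (.inr ⟨s(v, z), h⟩) (.inl z) := by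
    intro z h hz
    refine ⟨(hM.splitRel_inr_iff h hv hz _).2 (Or.inr rfl), ?_⟩
    rintro (⟨h', -⟩ | ⟨h', -⟩)
    · exact hne_vz z h (Sum.inr_injective h')
    · cases h'
  have hR₃₂ : ∀ i j, R₃ i j → R₂ i j := fun i j h => ⟨Or.inl h.1, h.2⟩
  -- a common witness for making `e₁` adjacent to the edges at `v`
  have hwit : ∀ p q, ((p = .inr e₁ ∧ T q) ∨ (T p ∧ q = .inr e₁)) →
      ∃ a, a ≠ p ∧ a ≠ q ∧ ¬ R₁ a a ∧ ∀ b, R₁ a b → R₃ p b ∨ R₃ q b := by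
    have aux : ∀ z (h : G.Adj v z), z ∈ A → z ≠ z₀ → ∃ a : V ⊕ G.edgeSet, a ≠ .inr e₁ ∧
        a ≠ .inr ⟨s(v, z), h⟩ ∧ ¬ R₁ a a ∧
        ∀ b, R₁ a b → R₃ (.inr e₁) b ∨ R₃ (.inr ⟨s(v, z), h⟩) b := by
      intro z h hz hzz
      -- Domination makes `wz` an edge. Its two neighbours `w` and `z` are adjacent to `e₁` and to
      -- `vz` respectively.
      refine ⟨.inr ⟨s(w, z), hdom z hz h⟩, fun h' => hne_wz z _ hzz (Sum.inr_injective h'),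
        fun h' => ?_, fun h' => ?_, fun b hb => ?_⟩
      · exact hwzT z (hdom z hz h) ⟨z, h, hz, hzz, h'⟩
      · rcases hR₁wz z _ hz hzz _ h' with h' | h' <;> cases h'
      · rcases hR₁wz z _ hz hzz b hb with rfl | rfl
        · exact Or.inl hR₃w
        · exact Or.inr (hR₃vz z h hz)
    rintro p q (⟨rfl, z, h, hz, hzz, rfl⟩ | ⟨⟨z, h, hz, hzz, rfl⟩, rfl⟩)
    · exact aux z h hz hzz
    · obtain ⟨a, h1, h2, h3, h4⟩ := aux z h hz hzz
      exact ⟨a, h2, h1, h3, fun b hb => (h4 b hb).symm⟩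
  obtain ⟨E₁⟩ : Nonempty (indPts R₀ ≃ₕ indPts R₁) := by
    refine indPts_homotopyEquiv_of_le (fun i j h => Or.inl h) s₀ s₁ fun p q h1 h0 => ?_
    obtain ⟨a, h2, h3, h4, h5⟩ := hwit p q (h1.resolve_left h0)
    exact ⟨a, h2, h3, h4, fun b hb => Or.inr ((h5 b hb).imp And.left And.left)⟩
  obtain ⟨E₂⟩ : Nonempty (indPts R₂ ≃ₕ indPts R₁) := by
    refine indPts_homotopyEquiv_of_le (fun i j h => h.1) s₂ s₁ fun p q h1 h2 => ?_
    have hdel : del p q := by_contra fun h => h2 ⟨h1, h⟩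
    -- The vertex `v` is the witness: the edge `vz₀` is adjacent to `z₀`, and the other edges at `v`
    -- have just been joined to `e₁`.
    have hb : ∀ b, R₁ (.inl v) b → R₂ (.inr e₁) b ∨ R₂ (.inl z₀) b := by
      rintro b (hb | ⟨h, -⟩ | ⟨h, -⟩)
      · obtain ⟨z, hz, hzA, rfl⟩ := (hM.splitRel_inl_iff hv b).1 hb
        by_cases hzz : z = z₀
        · subst hzz
          exact Or.inr (hR₃₂ _ _ (s₃ (hR₃vz z hz hzA)))
        · refine Or.inl ⟨Or.inr (Or.inl ⟨rfl, z, hz, hzA, hzz, rfl⟩), ?_⟩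
          rintro (⟨-, h⟩ | ⟨h, -⟩) <;> cases h
      · cases h
      · exact absurd h (hinlT v)
    have hvv : ¬ R₁ (.inl v) (.inl v) := by
      rintro (h | ⟨h, -⟩ | ⟨h, -⟩)
      · exact h.2.1 hv
      · cases h
      · exact hinlT v h
    have hvz : (.inl v : V ⊕ G.edgeSet) ≠ .inl z₀ := fun h => hvz₀.ne (Sum.inl_injective h)
    rcases hdel with ⟨rfl, rfl⟩ | ⟨rfl, rfl⟩
    · exact ⟨.inl v, by simp, hvz, hvv, fun b h => Or.inr (hb b h)⟩
    · exact ⟨.inl v, hvz, by simp, hvv, fun b h => Or.inr (hb b h).symm⟩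
  obtain ⟨E₃⟩ : Nonempty (indPts R₃ ≃ₕ indPts R₂) := by
    refine indPts_homotopyEquiv_of_le hR₃₂ s₃ s₂ fun p q h2 h3 => ?_
    obtain ⟨a, h4, h5, h6, h7⟩ := hwit p q (h2.1.resolve_left fun h => h3 ⟨h, h2.2⟩)
    exact ⟨a, h4, h5, fun h => h6 h.1, fun b hb => Or.inr (h7 b hb.1)⟩
  have hUe₁ : ¬ U (.inr e₁) := by
    rintro ⟨z, h, -, hzz, h'⟩
    exact hne_wz z h hzz (Sum.inr_injective h').symm
  obtain ⟨E₄⟩ : Nonempty (indPts R₃ ≃ₕ indPts R₄) := by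
    refine indPts_homotopyEquiv_of_le (fun i j h => Or.inl h) s₃ s₄ fun p q h4 h3 => ?_
    obtain ⟨rfl, z, h, hz, hzz, rfl⟩ := h4.resolve_left h3
    have hb : ∀ b, R₄ (.inr e₁) b → b = .inl w := by
      rintro b (⟨h', h''⟩ | ⟨rfl, h'⟩)
      · refine ((hM.splitRel_inr_iff hwz₀ hw hz₀ b).1 h').resolve_right fun h => ?_
        exact h'' (Or.inl ⟨rfl, h⟩)
      · exact absurd h' hUe₁
    have hne : (.inr e₁ : V ⊕ G.edgeSet) ≠ .inr ⟨s(w, z), h⟩ := fun h' =>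
      hne_wz z h hzz (Sum.inr_injective h').symm
    refine ⟨.inr e₁, hne, hne, fun h' => ?_, fun b h' => ?_⟩
    · cases hb _ h'
    · obtain rfl := hb b h'
      refine Or.inr (Or.inl ⟨(hM.splitRel_inr_iff h hw hz _).2 (Or.inl rfl), ?_⟩)
      rintro (⟨h', -⟩ | ⟨h', -⟩)
      · exact hne h'.symm
      · cases h'
  have hUiff : ∀ e : G.edgeSet, U (.inr e) ↔ EdgeIn A e ∧ w ∈ (e : Sym2 V) ∧ e ≠ e₁ := by
    intro e
    constructor
    · rintro ⟨z, h, hz, hzz, h'⟩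
      obtain rfl := Sum.inr_injective h'
      refine ⟨fun y hy => ?_, by simp, hne_wz z h hzz⟩
      rcases Sym2.mem_iff.1 hy with rfl | rfl <;> assumption
    · rintro ⟨h1, h2, h3⟩
      obtain ⟨e, he⟩ := e
      obtain ⟨z, rfl⟩ := h2
      refine ⟨z, he, h1 z (by simp), ?_, rfl⟩
      rintro rfl
      exact h3 rfl
  have hinlU : ∀ x, ¬ U (.inl x) := by
    rintro x ⟨_, _, _, _, h⟩
    cases h
  have hEdgeIn : ∀ e : G.edgeSet, EdgeIn (A \ {w}) e ↔ EdgeIn A e ∧ w ∉ (e : Sym2 V) := by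
    intro e
    refine ⟨fun h => ⟨fun y hy => (h y hy).1, fun hwe => (h w hwe).2 rfl⟩,
      fun h y hy => ⟨h.1 y hy, ?_⟩⟩
    rintro rfl
    exact h.2 hy
  have hdiag_inr : ∀ e : G.edgeSet, R₄ (.inr e) (.inr e) ↔
      splitRel (A \ {w}) (insert (w, e₁) M) (.inr e) (.inr e) := by
    intro e
    have h1 : R₄ (.inr e) (.inr e) ↔ (¬ EdgeIn A e ∧ ∀ x, (x, e) ∉ M) ∨ U (.inr e) := by
      simp [R₄, R₃, R₀, splitRel, del]
    rw [h1, hUiff]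
    simp only [splitRel, hEdgeIn, Set.mem_insert_iff, Prod.mk.injEq, true_and]
    have h2 : EdgeIn A e → ∀ x, (x, e) ∉ M := fun h x hx => hM.not_edgeIn x e hx h
    by_cases he : e = e₁
    · subst he
      constructor
      · rintro (h | h)
        · exact absurd he₁in h.1
        · exact absurd rfl h.2.2
      · rintro ⟨-, h⟩
        exact absurd (Or.inl ⟨rfl, rfl⟩) (h w)
    · by_cases h3 : EdgeIn A e
      · simp [h3, he, h2 h3]
      · simp [h3, he]
  have hdiag_inl : ∀ x : V, R₄ (.inl x) (.inl x) ↔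
      splitRel (A \ {w}) (insert (w, e₁) M) (.inl x) (.inl x) := by
    intro x
    have h1 : R₄ (.inl x) (.inl x) ↔ x ∉ A ∧ ∀ e, (x, e) ∉ M := by
      simp [R₄, R₃, R₀, splitRel, del, hinlU]
    rw [h1]
    simp only [splitRel, Set.mem_insert_iff, Prod.mk.injEq, Set.mem_sdiff,
      Set.mem_singleton_iff, true_and]
    by_cases hx : x = w
    · subst hx
      simp only [hw, not_true_eq_false, false_and, true_and, false_iff]
      rintro ⟨-, h⟩
      exact h e₁ (Or.inl rfl)
    · simp [hx]
  have hoff : ∀ (x : V) (e : G.edgeSet), ¬ R₄ (.inr e) (.inr e) → (R₄ (.inl x) (.inr e) ↔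
      splitRel (A \ {w}) (insert (w, e₁) M) (.inl x) (.inr e)) := by
    intro x e he
    have h1 : R₄ (.inl x) (.inr e) ↔ Incident A M x e ∧ ¬ (x = z₀ ∧ e = e₁) := by
      simp [R₄, R₃, R₀, splitRel, del]
    have hU : ¬ U (.inr e) := fun h => he (Or.inr ⟨rfl, h⟩)
    rw [hUiff] at hU
    rw [h1]
    simp only [splitRel, Incident, hEdgeIn, Set.mem_insert_iff, Prod.mk.injEq]
    constructor
    · rintro ⟨⟨h2, h3⟩ | h2, h4⟩
      · by_cases hwe : w ∈ (e : Sym2 V)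
        · have hee : e = e₁ := by_contra fun h => hU ⟨h3, hwe, h⟩
          subst hee
          rcases Sym2.mem_iff.1 h2 with rfl | rfl
          · exact Or.inr (Or.inl ⟨rfl, rfl⟩)
          · exact absurd ⟨rfl, rfl⟩ h4
        · exact Or.inl ⟨h2, h3, hwe⟩
      · exact Or.inr (Or.inr h2)
    · rintro (⟨h2, h3, h4⟩ | ⟨rfl, rfl⟩ | h2)
      · refine ⟨Or.inl ⟨h2, h3⟩, ?_⟩
        rintro ⟨-, rfl⟩
        exact h4 (by simp [he₁])
      · exact ⟨Or.inl ⟨by simp [he₁], he₁in⟩, fun h => hwz₀.ne h.1⟩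
      · refine ⟨Or.inr h2, ?_⟩
        rintro ⟨-, rfl⟩
        exact hM.not_edgeIn _ _ h2 he₁in
  refine ⟨insert (w, e₁) M, Set.subset_insert _ _, Set.insert_nonempty _ _,
    hM.isSplit_insert Set.sdiff_subset hw (fun h => h.2 rfl) he₁in
      (fun h => (h w (by simp [he₁])).2 rfl), ?_⟩
  · have hcongr : indPts R₄ = indPts (splitRel (A \ {w}) (insert (w, e₁) M)) := by
      refine indPts_congr ?_ ?_
      · rintro (x | e)
        · exact hdiag_inl x
        · exact hdiag_inr e
      · rintro (x | e) (y | f) h h'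
        · by_cases hxy : x = y
          · subst hxy
            exact hdiag_inl x
          · simp [R₄, R₃, R₀, splitRel, hxy]
        · exact hoff x f h'
        · exact Iff.trans ⟨fun h => s₄ h, fun h => s₄ h⟩ (hoff y e h)
        · by_cases hef : e = f
          · subst hef
            exact hdiag_inr e
          · simp [R₄, R₃, R₀, splitRel, hef]
    exact ⟨(E₁.trans E₂.symm).trans (E₃.symm.trans (E₄.trans (hcongr ▸ .refl _)))⟩

/-- Moving an isolated edge out of `S(G[A])`. -/
lemma IsSplit.exists_homotopyEquiv_of_isolated [Fintype (V ⊕ G.edgeSet)]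
    {A : Set V} {M : Set (V × G.edgeSet)} (hM : IsSplit A M) {u v : V} (hu : u ∈ A)
    (hv : v ∈ A) (huv : G.Adj u v) (hNu : ∀ z ∈ A, G.Adj u z → z = v)
    (hNv : ∀ z ∈ A, G.Adj v z → z = u) : ∃ M', M ⊆ M' ∧ M'.Nonempty ∧ IsSplit (A \ {u, v}) M' ∧
      Nonempty (indPts (splitRel A M) ≃ₕ indPts (splitRel (A \ {u, v}) M')) := by
  set e₁ : G.edgeSet := ⟨s(u, v), huv⟩ with he₁
  have he₁in : EdgeIn A e₁ := fun y hy => by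
    rcases Sym2.mem_iff.1 hy with rfl | rfl <;> assumption
  let R₀ := splitRel A M
  -- The component is a path `u, e₁, v`. The only neighbour of `u` is also a neighbour of `v`, so
  -- `v` can be deleted.
  let R₁ : V ⊕ G.edgeSet → V ⊕ G.edgeSet → Prop := fun a b => R₀ a b ∨ (a = .inl v ∧ b = .inl v)
  have s₀ : ∀ ⦃i j⦄, R₀ i j → R₀ j i := splitRel_symm A M
  have s₁ : ∀ ⦃i j⦄, R₁ i j → R₁ j i := fun i j h => h.imp (@s₀ i j) And.symm
  have huu : ¬ R₁ (.inl u) (.inl u) := by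
    rintro (h | h)
    · exact h.2.1 hu
    · exact huv.ne (Sum.inl_injective h.1)
  obtain ⟨E₁⟩ : Nonempty (indPts R₀ ≃ₕ indPts R₁) := by
    refine indPts_homotopyEquiv_of_le (fun i j h => Or.inl h) s₀ s₁ fun p q h1 h0 => ?_
    obtain ⟨rfl, rfl⟩ := h1.resolve_left h0
    have hne : (.inl u : V ⊕ G.edgeSet) ≠ .inl v := fun h => huv.ne (Sum.inl_injective h)
    refine ⟨.inl u, hne, hne, huu, fun b hb => Or.inr (Or.inl ?_)⟩
    have hb' := hb.resolve_right fun h => hne h.1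
    obtain ⟨y, hy, hyA, rfl⟩ := (hM.splitRel_inl_iff hu b).1 hb'
    obtain rfl := hNu y hyA hy
    exact s₀ ((hM.splitRel_inr_iff hy hu hyA _).2 (Or.inr rfl))
  have heq : ∀ e : G.edgeSet, EdgeIn A e → (u ∈ (e : Sym2 V) ∨ v ∈ (e : Sym2 V)) → e = e₁ := by
    rintro ⟨e, he⟩ h1 (⟨y, rfl⟩ | ⟨y, rfl⟩)
    · obtain rfl := hNu y (h1 y (by simp)) he
      rfl
    · obtain rfl := hNv y (h1 y (by simp)) he
      exact Subtype.ext Sym2.eq_swap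
  have hEdgeIn : ∀ e : G.edgeSet, EdgeIn (A \ {u, v}) e ↔ EdgeIn A e ∧ e ≠ e₁ := by
    intro e
    constructor
    · refine fun h => ⟨fun y hy => (h y hy).1, ?_⟩
      rintro rfl
      exact (h u (by simp [he₁])).2 (by simp)
    · rintro ⟨h1, h2⟩ y hy
      refine ⟨h1 y hy, ?_⟩
      rintro (rfl | rfl)
      · exact h2 (heq e h1 (Or.inl hy))
      · exact h2 (heq e h1 (Or.inr hy))
  have hdiag_inr : ∀ e : G.edgeSet, R₁ (.inr e) (.inr e) ↔
      splitRel (A \ {u, v}) (insert (u, e₁) M) (.inr e) (.inr e) := by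
    intro e
    have h1 : R₁ (.inr e) (.inr e) ↔ ¬ EdgeIn A e ∧ ∀ x, (x, e) ∉ M := by
      simp [R₁, R₀, splitRel]
    rw [h1]
    simp only [splitRel, hEdgeIn, Set.mem_insert_iff, Prod.mk.injEq, true_and]
    by_cases he : e = e₁
    · subst he
      constructor
      · rintro h
        exact absurd he₁in h.1
      · rintro ⟨-, h⟩
        exact absurd (Or.inl ⟨rfl, rfl⟩) (h u)
    · simp [he]
  have hdiag_inl : ∀ x : V, R₁ (.inl x) (.inl x) ↔
      splitRel (A \ {u, v}) (insert (u, e₁) M) (.inl x) (.inl x) := by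
    intro x
    have h1 : R₁ (.inl x) (.inl x) ↔ (x ∉ A ∧ ∀ e, (x, e) ∉ M) ∨ x = v := by
      simp [R₁, R₀, splitRel]
    rw [h1]
    simp only [splitRel, Set.mem_insert_iff, Prod.mk.injEq, Set.mem_sdiff,
      Set.mem_singleton_iff, true_and]
    by_cases hx : x = u
    · subst hx
      simp only [hu, not_true_eq_false, false_and, true_and, huv.ne, false_or, false_iff]
      rintro ⟨-, h⟩
      exact h e₁ (Or.inl rfl)
    · by_cases hxv : x = v
      · subst hxv
        simp only [or_true, true_iff, not_true_eq_false, and_false, not_false_eq_true, true_and,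
          hx, false_and, false_or]
        exact fun e he => hM.notMem _ _ he hv
      · simp [hx, hxv]
  have hoff : ∀ (x : V) (e : G.edgeSet), ¬ R₁ (.inl x) (.inl x) → (R₁ (.inl x) (.inr e) ↔
      splitRel (A \ {u, v}) (insert (u, e₁) M) (.inl x) (.inr e)) := by
    intro x e hx
    have h1 : R₁ (.inl x) (.inr e) ↔ Incident A M x e := by
      simp [R₁, R₀, splitRel]
    have hxv : x ≠ v := by
      rintro rfl
      exact hx (Or.inr ⟨rfl, rfl⟩)
    rw [h1]
    simp only [splitRel, Incident, hEdgeIn, Set.mem_insert_iff, Prod.mk.injEq]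
    constructor
    · rintro (⟨h2, h3⟩ | h2)
      · by_cases hee : e = e₁
        · subst hee
          rcases Sym2.mem_iff.1 h2 with rfl | rfl
          · exact Or.inr (Or.inl ⟨rfl, rfl⟩)
          · exact absurd rfl hxv
        · exact Or.inl ⟨h2, h3, hee⟩
      · exact Or.inr (Or.inr h2)
    · rintro (⟨h2, h3, -⟩ | ⟨rfl, rfl⟩ | h2)
      · exact Or.inl ⟨h2, h3⟩
      · exact Or.inl ⟨by simp [he₁], he₁in⟩
      · exact Or.inr h2
  refine ⟨insert (u, e₁) M, Set.subset_insert _ _, Set.insert_nonempty _ _,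
    hM.isSplit_insert Set.sdiff_subset hu (fun h => h.2 (Or.inl rfl)) he₁in
      (fun h => (h u (by simp [he₁])).2 (Or.inl rfl)), ?_⟩
  · have hcongr : indPts R₁ = indPts (splitRel (A \ {u, v}) (insert (u, e₁) M)) := by
      refine indPts_congr ?_ ?_
      · rintro (x | e)
        · exact hdiag_inl x
        · exact hdiag_inr e
      · rintro (x | e) (y | f) h h'
        · by_cases hxy : x = y
          · subst hxy
            exact hdiag_inl x
          · constructor
            · intro h''
              rcases h'' with h'' | h''
              · exact absurd h''.1 hxy
              · exact absurd (Sum.inl_injective (h''.1.trans h''.2.symm)) hxy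
            · exact fun h'' => absurd h''.1 hxy
        · exact hoff x f h
        · exact Iff.trans ⟨fun h => s₁ h, fun h => s₁ h⟩ (hoff y e h')
        · by_cases hef : e = f
          · subst hef
            exact hdiag_inr e
          · simp [R₁, R₀, splitRel, hef]
    exact ⟨E₁.trans (hcongr ▸ .refl _)⟩

/-- `S(G[A])` can be replaced by `S(G[A'])` at the cost of a larger matching. -/
def SplitsOff (G : SimpleGraph V) [Fintype (V ⊕ G.edgeSet)] (A A' : Set V) : Prop :=
  ∀ M : Set (V × G.edgeSet), IsSplit A M → ∃ M', M ⊆ M' ∧ (A' ≠ A → M'.Nonempty) ∧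
    IsSplit A' M' ∧ Nonempty (indPts (splitRel A M) ≃ₕ indPts (splitRel A' M'))

variable [Fintype (V ⊕ G.edgeSet)]

lemma SplitsOff.refl (A : Set V) : SplitsOff G A A := fun M hM =>
  ⟨M, subset_rfl, fun h => absurd rfl h, hM, ⟨.refl _⟩⟩

lemma SplitsOff.trans {A B C : Set V} (h : SplitsOff G A B) (h' : SplitsOff G B C) :
    SplitsOff G A C := by
  intro M hM
  obtain ⟨M₁, h1, h2, h3, ⟨e⟩⟩ := h M hM
  obtain ⟨M₂, h4, h5, h6, ⟨f⟩⟩ := h' M₁ h3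
  refine ⟨M₂, h1.trans h4, fun hne => ?_, h6, ⟨e.trans f⟩⟩
  by_cases hCB : C = B
  · subst hCB
    exact (h2 hne).mono h4
  · exact h5 hCB

/-- The vertices of `D` are removed singly. Neither `v` nor its neighbour `z₀` is ever removed, and
domination passes to smaller sets. -/
lemma SplitsOff.diff_of_dominated {A D : Set V} (hD : D.Finite) (hDA : D ⊆ A) {v z₀ : V}
    (hv : v ∈ A) (hvD : v ∉ D) (hz₀ : z₀ ∈ A) (hz₀D : z₀ ∉ D) (hvz₀ : G.Adj v z₀)
    (hdom : ∀ w ∈ D, ∀ z ∈ A, G.Adj v z → G.Adj w z) : SplitsOff G A (A \ D) := by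
  induction D, hD using Set.Finite.induction_on with
  | empty => simpa using SplitsOff.refl A
  | @insert w D hwD _ ih =>
    rw [Set.mem_insert_iff, not_or] at hvD hz₀D
    have h1 := ih ((Set.subset_insert w D).trans hDA) hvD.2 hz₀D.2
      fun x hx => hdom x (Set.mem_insert_of_mem w hx)
    refine h1.trans fun M hM => ?_
    obtain ⟨M', h2, h3, h4, h5⟩ := hM.exists_homotopyEquiv_of_dominated (v := v) (w := w)
      (z₀ := z₀) ⟨hv, hvD.2⟩ ⟨hDA (Set.mem_insert _ _), hwD⟩ hvD.1
      (fun z hz => hdom w (Set.mem_insert _ _) z hz.1) ⟨hz₀, hz₀D.2⟩ hvz₀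
    have h6 : (A \ D) \ {w} = A \ insert w D := by
      ext y
      simp only [Set.mem_sdiff, Set.mem_singleton_iff, Set.mem_insert_iff]
      tauto
    rw [h6] at h4 h5
    exact ⟨M', h2, fun _ => h3, h4, h5⟩

/-- By bisimpliciality, every neighbour of `u` other than `v` dominates `v`. Once these are gone,
`v` is the only neighbour of `u`, so the other neighbours of `v` dominate `u`. What remains of the
neighbourhood is the isolated edge `uv`. -/
lemma IsBisimplicialPair.splitsOff [Finite V] {A : Set V} {u v : V}
    (h : IsBisimplicialPair G A u v) : SplitsOff G A (remaining G A u v) := by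
  obtain ⟨hu, hv, huv, hb⟩ := h
  let D₁ : Set V := {w | w ∈ A ∧ G.Adj u w ∧ w ≠ v}
  let D₂ : Set V := {w | w ∈ A \ D₁ ∧ G.Adj v w ∧ w ≠ u}
  have hu₁ : u ∉ D₁ := fun h => h.2.1.ne rfl
  have hv₁ : v ∉ D₁ := fun h => h.2.2 rfl
  have hu₂ : u ∉ D₂ := fun h => h.2.2 rfl
  have hv₂ : v ∉ D₂ := fun h => h.2.1.ne rfl
  have hNu : ∀ z ∈ A \ D₁, G.Adj u z → z = v := fun z hz huz =>
    by_contra fun hne => hz.2 ⟨hz.1, huz, hne⟩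
  have h1 : SplitsOff G A (A \ D₁) :=
    SplitsOff.diff_of_dominated (Set.toFinite _) (fun w hw => hw.1) hv hv₁ hu hu₁ huv.symm
      fun w hw z hz hvz => hb w hw.1 z hz hw.2.1 hvz
  have h2 : SplitsOff G (A \ D₁) ((A \ D₁) \ D₂) :=
    SplitsOff.diff_of_dominated (Set.toFinite _) (fun w hw => hw.1) ⟨hu, hu₁⟩ hu₂
      ⟨hv, hv₁⟩ hv₂ huv fun w hw z hz huz => by
        rw [hNu z hz huz]
        exact hw.2.1.symm
  have h3 : SplitsOff G ((A \ D₁) \ D₂) (((A \ D₁) \ D₂) \ {u, v}) := fun M hM => by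
    obtain ⟨M', h4, h5, h6⟩ := hM.exists_homotopyEquiv_of_isolated ⟨⟨hu, hu₁⟩, hu₂⟩
      ⟨⟨hv, hv₁⟩, hv₂⟩ huv (fun z hz => hNu z hz.1)
      fun z hz hvz => by_contra fun hne => hz.2 ⟨hz.1, hvz, hne⟩
    exact ⟨M', h4, fun _ => h5, h6⟩
  have h4 : ((A \ D₁) \ D₂) \ {u, v} = remaining G A u v := by
    ext w
    simp only [D₁, D₂, remaining, Set.mem_sdiff, Set.mem_ofPred_eq, Set.mem_insert_iff,
      Set.mem_singleton_iff]
    by_cases hwu : w = u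
    · subst hwu
      simp [huv.symm]
    by_cases hwv : w = v
    · subst hwv
      simp [huv]
    tauto
  exact h4 ▸ h1.trans (h2.trans h3)

lemma IsElimSeq.splitsOff [Finite V] {E : List (Sym2 V)} (hE : IsElimSeq G E) {i : ℕ}
    (hi : i ≤ E.length) : SplitsOff G Set.univ (elimGraph G E i).verts := by
  induction i with
  | zero => simpa [elimGraph] using SplitsOff.refl Set.univ
  | succ i ih =>
    obtain ⟨u, v, hb, hv⟩ := hE.exists_pair hi
    exact (ih (by omega)).trans (hv ▸ hb.splitsOff)

lemma indPts_subdivision :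
    indPts (subdivision G).Adj = indPts (splitRel Set.univ (∅ : Set (V × G.edgeSet))) := by
  congr 1
  ext i j
  rcases i with x | e <;> rcases j with y | f <;>
    simp [subdivision, splitRel, Incident, EdgeIn]

lemma IsSplit.contractibleSpace {A : Set V} {M : Set (V × G.edgeSet)} (hM : IsSplit A M)
    (hA : ∀ x ∈ A, ∀ y ∈ A, ¬ G.Adj x y) {x : V} (hx : x ∈ A) :
    ContractibleSpace (indPts (splitRel A M)) := by
  have h : ∀ b, ¬ splitRel A M (.inl x) b := by
    intro b hb
    obtain ⟨y, hxy, hy, -⟩ := (hM.splitRel_inl_iff hx b).1 hb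
    exact hA x hx y hy hxy
  exact contractibleSpace_indPts (splitRel_symm A M) (.inl x) (h _) fun b hb => absurd hb (h b)

lemma IsSplit.isHomotopySphere [Finite V] {M : Set (V × G.edgeSet)} (hM : IsSplit ∅ M)
    (hne : M.Nonempty) : IsHomotopySphere (indPts (splitRel ∅ M)) := by
  have hin : ∀ e : G.edgeSet, ¬ EdgeIn ∅ e := by
    rintro ⟨e, he⟩ h
    induction e using Sym2.ind with
    | _ x y => exact h x (by simp)
  have : Nonempty M := hne.to_subtype
  obtain ⟨n, ⟨φ⟩⟩ := Finite.exists_equiv_fin M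
  obtain ⟨d, rfl⟩ : ∃ d, n = d + 1 := by
    refine Nat.exists_eq_succ_of_ne_zero ?_
    rintro rfl
    exact (φ ⟨_, hne.some_mem⟩).elim0
  -- The two ends of the `k`-th matching edge are the opposite vertices on the `k`-th axis of the
  -- cross-polytope.
  let ψ : Fin (d + 1) × Bool → V ⊕ G.edgeSet := fun p =>
    if p.2 then .inl (φ.symm p.1).1.1 else .inr (φ.symm p.1).1.2
  have hinj₁ : ∀ k l, (φ.symm k).1.1 = (φ.symm l).1.1 → k = l := by
    intro k l h
    apply φ.symm.injective
    refine Subtype.ext (Prod.ext h (hM.inj_left _ _ _ (φ.symm k).2 ?_))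
    rw [h]
    exact (φ.symm l).2
  have hinj₂ : ∀ k l, (φ.symm k).1.2 = (φ.symm l).1.2 → k = l := by
    intro k l h
    apply φ.symm.injective
    refine Subtype.ext (Prod.ext (hM.inj_right _ _ _ (φ.symm k).2 ?_) h)
    rw [h]
    exact (φ.symm l).2
  have hmem : ∀ k, ((φ.symm k).1.1, (φ.symm k).1.2) ∈ M := fun k => (φ.symm k).2
  have hmem_iff : ∀ k l, ((φ.symm k).1.1, (φ.symm l).1.2) ∈ M ↔ k = l := by
    refine fun k l => ⟨fun h => hinj₂ k l (hM.inj_left _ _ _ (hmem k) h), ?_⟩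
    rintro rfl
    exact hmem k
  suffices hψ : Function.Injective ψ ∧ (∀ i, i ∉ Set.range ψ → splitRel ∅ M i i) ∧
      ∀ p q, splitRel ∅ M (ψ p) (ψ q) ↔ p.1 = q.1 ∧ p.2 ≠ q.2 by
    obtain ⟨e⟩ := nonempty_homeomorph_indPts_sphere ψ hψ.1 hψ.2.1 hψ.2.2
    exact ⟨d, ⟨e.toHomotopyEquiv⟩⟩
  refine ⟨?_, ?_, ?_⟩
  · rintro ⟨k, b⟩ ⟨l, c⟩ h
    cases b <;> cases c <;> simp [ψ] at h
    · rw [hinj₂ k l h]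
    · rw [hinj₁ k l h]
  · rintro (x | e) h
    · refine ⟨rfl, Set.notMem_empty x, fun e he => h ⟨(φ ⟨_, he⟩, true), ?_⟩⟩
      simp [ψ]
    · refine ⟨rfl, hin e, fun x hx => h ⟨(φ ⟨_, hx⟩, false), ?_⟩⟩
      simp [ψ]
  · rintro ⟨k, b⟩ ⟨l, c⟩
    cases b <;> cases c
    · simp only [ψ, splitRel, Bool.false_eq_true, if_false, ne_eq, not_true_eq_false, and_false,
        iff_false, not_and, not_forall, not_not]
      exact fun _ _ => ⟨_, hmem k⟩
    · simp [ψ, splitRel, Incident, hin, hmem_iff]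
      exact eq_comm
    · simp [ψ, splitRel, Incident, hin, hmem_iff]
    · simp only [ψ, splitRel, if_true, ne_eq, not_true_eq_false, and_false,
        iff_false, not_and, not_forall, not_not]
      exact fun _ _ => ⟨_, hmem k⟩

lemma IsElimSeq.contractibleSpace [Finite V] {E : List (Sym2 V)} (hE : IsElimSeq G E) {x : V}
    (hx : x ∈ (elimGraph G E E.length).verts) :
    ContractibleSpace (realization (indComplex (subdivision G))) := by
  rw [realization_indComplex, indPts_subdivision]
  obtain ⟨M, -, -, hM, ⟨e⟩⟩ := hE.splitsOff le_rfl ∅ ⟨by simp, by simp, by simp, by simp⟩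
  have := hM.contractibleSpace hE.not_adj hx
  exact e.contractibleSpace

lemma IsElimSeq.isHomotopySphere [Finite V] {E : List (Sym2 V)} (hE : IsElimSeq G E)
    (h : (elimGraph G E E.length).verts = ∅) :
    IsHomotopySphere (realization (indComplex (subdivision G))) := by
  rw [realization_indComplex, indPts_subdivision]
  obtain ⟨M, -, hne, hM, ⟨e⟩⟩ := hE.splitsOff le_rfl ∅ ⟨by simp, by simp, by simp, by simp⟩
  rw [h] at hne hM e
  -- The sequence has a first edge, so something is split off and the matching is nonempty; this
  -- rules out the empty sphere.
  have huniv : (∅ : Set V) ≠ Set.univ := by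
    obtain ⟨u, v, hb, -⟩ := hE.exists_pair (i := 0) (List.length_pos_of_ne_nil hE.ne_nil)
    intro h
    exact (h ▸ Set.mem_univ u : u ∈ (∅ : Set V))
  obtain ⟨d, ⟨f⟩⟩ := hM.isHomotopySphere (hne huniv)
  exact ⟨d, ⟨e.trans f⟩⟩

end Subdivision

end BicliqueElim

/-! ### The two assertions combined. -/

theorem mainTheorem8 {V : Type*} [Finite V] (B : SimpleGraph V) (hB : B.IsBipartite) :
    (∀ E : List (Sym2 V), BicliqueElim.IsCompleteSimpleElimSeq B E →
      ∀ F : List (Sym2 V), BicliqueElim.IsSimpleElimSeq B F →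
        BicliqueElim.IsCompleteSimpleElimSeq B F ∧ F.length = E.length) ∧
    ((∃ E : List (Sym2 V), BicliqueElim.IsSimpleElimSeq B E) →
      (BicliqueElim.IsHomotopySphere
          (BicliqueElim.realization (BicliqueElim.indComplex (BicliqueElim.subdivision B))) ↔
        ∃ E : List (Sym2 V), BicliqueElim.IsCompleteSimpleElimSeq B E)) := by
  have := Fintype.ofFinite (V ⊕ B.edgeSet)
  refine ⟨fun E hE F hF => ?_, ?_⟩
  · obtain ⟨h1, h2⟩ := hE.1.toIsElimSeq.isoSeq_eq_empty_and_length_eq hE.2 hF.toIsElimSeq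
    exact ⟨⟨hF, h1⟩, h2⟩
  · rintro ⟨E, hE⟩
    constructor
    · rintro ⟨d, ⟨e⟩⟩
      -- The given sequence is itself complete: a leftover vertex would make the complex, and hence
      -- a sphere, contractible.
      refine ⟨E, hE, hE.toIsElimSeq.isoSeq_eq_empty ?_⟩
      rw [Set.eq_empty_iff_forall_notMem]
      intro x hx
      have := hE.toIsElimSeq.contractibleSpace hx
      exact BicliqueElim.not_contractibleSpace_sphere d e.symm.contractibleSpace
    · rintro ⟨F, hF, hiso⟩
      exact hF.toIsElimSeq.isHomotopySphere (hF.toIsElimSeq.verts_eq_empty hiso)
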